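/- Let $\mathrm{Ai}$ be the Airy function of the first kind, $\mathrm{Ai}(x)=\frac1\pi\int_0^\infty\cos\bigl(\frac{t^3}{3}+xt\bigr)\,dt$, and for real $c$ let $\mathcal T_c\colon L^2[0,\infty)\to L^2[0,\infty)$ be the Airy integral operator $$\mathcal T_c[f](x)=\int_0^\infty \mathrm{Ai}(x+y+c)\,f(y)\,dy,\qquad x\ge 0.$$ Let $\lambda_{0,c},\lambda_{1,c},\dots$ be the eigenvalues of $\mathcal T_c$, listed with multiplicity and ordered so that $|\lambda_{j-1,c}|\ge|\lambda_{j,c}|$, and let $\psi_{0,c},\psi_{1,c},\dots$ be corresponding (real) eigenfunctions, so that $\lambda_{j,c}\psi_{j,c}(x)=\mathcal T_c[\psi_{j,c}](x)$ for all $x\ge0$, where for each $\mu$ the $\psi_{j,c}$ with $\lambda_{j,c}=\mu$ form a basis of the eigenspace of $\mu$, normalized by $\|\psi_{j,c}\|_{L^2[0,\infty)}=1$ and $\psi_{j,c}(0)>0$. Let $c$ be real, let $m,n$ be non-negative integers, and write $\lambda_j=\lambda_{j,c}$, $\psi_j=\psi_{j,c}$. Then $\psi_n$ is twice continuously differentiable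 on $[0,\infty)$ (one-sidedly at $0$), the derivative $\frac{\partial\psi_n}{\partial c}(x)=\frac{\partial \psi_{n,c}(x)}{\partial c}$ exists for every $x\ge0$, all integrals below converge absolutely, all denominators below are nonzero, and $$\int_0^\infty \psi_n'(x)\psi_m(x)\,dx=-\frac{\lambda_m}{\lambda_n+\lambda_m}\,\psi_n(0)\psi_m(0);$$ and if $m\ne n$, then $$\int_0^\infty \psi_n''(x)\psi_m(x)\,dx=\frac{\lambda_m}{\lambda_n-\lambda_m}\bigl(\psi_n'(0)\psi_m(0)-\psi_n(0)\psi_m'(0)\bigr),$$ $$\int_0^\infty x\,\psi_n(x)\psi_m(x)\,dx=\frac{\lambda_n\lambda_m}{\lambda_n^2-\lambda_m^2}\bigl(\psi_n'(0)\psi_m(0)-\psi_n(0)\psi_m'(0)\bigr),$$ $$\int_0^\infty \frac{\partial\psi_n}{\partial c}(x)\,\psi_m(x)\,dx=\frac{\lambda_n\lambda_m}{\lambda_m^2-\lambda_n^2}\,\psi_m(0)\psi_n(0).$$ -/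

import Mathlib

open MeasureTheory Set Filter

noncomputable section

/-- The Airy function of the first kind,
`Ai x = (1/π) ∫₀^∞ cos (t³/3 + x t) dt`. The integral converges only conditionally, so it is
the limit of the integrals over `[0, R]` as `R → ∞`; this limit exists for every real `x`. -/
def airyAi (x : ℝ) : ℝ :=
  limUnder atTop fun R : ℝ =>
    (1 / Real.pi) * ∫ t in (0 : ℝ)..R, Real.cos (t ^ 3 / 3 + x * t)

/-- The Airy integral operator `T_c`, `T_c[f](x) = ∫₀^∞ Ai(x + y + c) f(y) dy`. -/
def airyOp (c : ℝ) (f : ℝ → ℝ) (x : ℝ) : ℝ :=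
  ∫ y in Ioi (0 : ℝ), airyAi (x + y + c) * f y

/-- `f` lies in the eigenspace of `T_c` on `L²[0, ∞)` for the number `μ` (`f = 0` is allowed):
`f` is square integrable on `[0, ∞)` and `μ f(x) = T_c[f](x)` for all `x ≥ 0`.
Values of `f` at negative arguments play no role. -/
def MemAiryEigenspace (c μ : ℝ) (f : ℝ → ℝ) : Prop :=
  MemLp f 2 (volume.restrict (Ioi (0 : ℝ))) ∧ ∀ x : ℝ, 0 ≤ x → μ * f x = airyOp c f x

/-- `lam 0, lam 1, …` are the eigenvalues of `T_c` on `L²[0, ∞)`, repeated according to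
multiplicity and ordered by decreasing absolute value, and `psi 0, psi 1, …` are corresponding
eigenfunctions, normalized by `‖psi j‖₂ = 1` and `psi j 0 > 0`. -/
structure IsAiryEigensystem (c : ℝ) (lam : ℕ → ℝ) (psi : ℕ → ℝ → ℝ) : Prop where
  /-- `psi j` satisfies the eigenvalue equation for `lam j` -/
  eigen : ∀ j, MemAiryEigenspace c (lam j) (psi j)
  /-- unit norm in `L²[0, ∞)` -/
  norm_one : ∀ j, ∫ x in Ioi (0 : ℝ), psi j x ^ 2 = 1
  /-- choice of sign -/
  pos_zero : ∀ j, 0 < psi j 0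
  /-- ordering by decreasing absolute value -/
  antitone_abs : Antitone fun j => |lam j|
  /-- every eigenvalue is listed, as often as its multiplicity: for every `μ`, the `psi j` with
  `lam j = μ` form a basis of the eigenspace of `μ` (as a subspace of `L²[0, ∞)`) -/
  basis : ∀ (μ : ℝ) (f : ℝ → ℝ), MemAiryEigenspace c μ f →
    ∃! a : {j : ℕ // lam j = μ} →₀ ℝ,
      f =ᵐ[volume.restrict (Ioi (0 : ℝ))] fun x => a.sum fun j t => t * psi j x

end

/-! Because the kernel depends on `x + y` only, `T_c` and every operator with kernel `Ai^(k)(x + y +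
c)` are symmetric, and the latter sends an eigenfunction `ψ` to `λ ψ^(k)`. Hence `λ_n ∫ ψ_n^(k) ψ_m
= λ_m ∫ ψ_n ψ_m^(k)` (`MemAiryEigenspace.smul_integral_eigenDeriv`). For `k = 0` this is
orthogonality; for `k = 1, 2`, combined with integration by parts, it gives the first two formulas.
Airy's equation at `x + y + c` gives `T_c[y ψ] = λ ψ'' - (x + c) λ ψ`, and pairing with `ψ_m` gives
the third.

The denominators need information on the spectrum. Zero is not an eigenvalue
(`ae_eq_zero_of_airyOp_eq_zero`): a null function `f` has `T_c[y^k f] = 0` for all `k`, so all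
moments of `Ai(y + c) f(y)` and of `Ai'(y + c) f(y)` vanish, while `Ai` and `Ai'` have no common
zero. Opposite eigenvalues are excluded by the `k = 1` identity, since every `ψ_j(0)` is positive.
If an eigenfunction vanished at `0`, its derivative would lie in the eigenspace of `-λ`, hence be
zero; so evaluation at `0` is injective on eigenspaces and the eigenvalues are simple. Therefore
`|λ_j|` is strictly decreasing.

Ordering and signs are chosen separately for each `c`, so differentiability in `c` has to be proved.
`T_c` is compact and self-adjoint, hence the `ψ_j` form a Hilbert basis, and `T_c` is differentiable
in operator norm. The abstract perturbation theorem `exists_hasDerivAt_eigenvector` then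
differentiates `λ_n` and `ψ_n` in `L²`; pointwise derivatives follow from `λ ψ(x) = ⟪Ai(x + c + ·),
ψ⟫`. Pairing the differentiated eigenvalue equation with `ψ_m` reduces the last formula to the
first. -/

/-! ### Contour representation and decay of the Airy function -/

/-- The entire function `z ↦ exp (i (z³/3 + x z))`. -/
noncomputable def airyExp (x : ℝ) (z : ℂ) : ℂ := Complex.exp (Complex.I * (z ^ 3 / 3 + x * z))

/-- The imaginary part of `(t + iη)³ / 3` is `η t² - η³ / 3`, so raising the contour to a height `η
> 0` turns an oscillating integrand into a Gaussian one. -/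
lemma norm_airyExp (x t η : ℝ) :
    ‖airyExp x (t + η * Complex.I)‖ = Real.exp (-(η * t ^ 2) + η ^ 3 / 3 - x * η) := by
  rw [airyExp, Complex.norm_exp]
  congr 1
  have h : Complex.I * (((t : ℂ) + η * Complex.I) ^ 3 / 3 + x * (t + η * Complex.I))
      = ((-(η * t ^ 2) + η ^ 3 / 3 - x * η : ℝ) : ℂ)
        + ((t ^ 3 / 3 - t * η ^ 2 + x * t : ℝ) : ℂ) * Complex.I := by
    push_cast
    linear_combination ((t : ℂ) ^ 2 * η + x * η + t * η ^ 2 * Complex.I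
      + η ^ 3 / 3 * (Complex.I ^ 2 - 1)) * Complex.I_sq
  rw [h, Complex.add_re, Complex.re_ofReal_mul, Complex.I_re, mul_zero, add_zero,
    Complex.ofReal_re]

lemma differentiable_airyExp (x : ℝ) : Differentiable ℂ (airyExp x) := by
  unfold airyExp; fun_prop

lemma continuous_airyExp_line (x η : ℝ) :
    Continuous fun t : ℝ => airyExp x (t + η * Complex.I) :=
  (differentiable_airyExp x).continuous.comp (by fun_prop)

/-- The integrand of the contour representation of the `k`-th derivative of the Airy function. -/
noncomputable def airyIntegrand (k : ℕ) (η x t : ℝ) : ℂ :=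
  (Complex.I * (t + η * Complex.I)) ^ k * airyExp x (t + η * Complex.I)

lemma continuous_airyIntegrand (k : ℕ) (η x : ℝ) : Continuous (airyIntegrand k η x) :=
  Continuous.mul (by fun_prop) (continuous_airyExp_line x η)

/-- The constant in the Gaussian bound for `airyIntegrand`. -/
noncomputable def airyConst (k : ℕ) (η : ℝ) : ℝ :=
  (k.factorial : ℝ) * Real.exp (η + 1 / (2 * η) + η ^ 3 / 3)

lemma airyConst_nonneg (k : ℕ) (η : ℝ) : 0 ≤ airyConst k η := by
  unfold airyConst; positivity

/-- Half of the Gaussian absorbs the polynomial factor, through `s^k ≤ k! e^s` and `|t| ≤ η t² / 2 +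
1 / (2η)`. The dependence on `x` is isolated in `exp (-(η * x))`, which serves both for decay in `x`
and for differentiation under the integral. -/
lemma norm_airyIntegrand_le (k : ℕ) {η : ℝ} (hη : 0 < η) (x t : ℝ) :
    ‖airyIntegrand k η x t‖
      ≤ airyConst k η * Real.exp (-(η * x)) * Real.exp (-(η / 2) * t ^ 2) := by
  have h1 : ‖(Complex.I * (t + η * Complex.I)) ^ k‖ ≤ (|t| + η) ^ k := by
    rw [norm_pow, norm_mul, Complex.norm_I, one_mul]
    gcongr
    refine (norm_add_le _ _).trans ?_
    simp [abs_of_pos hη]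
  have h2 : (|t| + η) ^ k ≤ k.factorial * Real.exp (|t| + η) := by
    have := Real.pow_div_factorial_le_exp (|t| + η) (by positivity) k
    rwa [div_le_iff₀' (by positivity)] at this
  have h3 : |t| ≤ η / 2 * t ^ 2 + 1 / (2 * η) := by
    have : 0 ≤ (η * |t| - 1) ^ 2 / (2 * η) := by positivity
    have e : (η * |t| - 1) ^ 2 / (2 * η) = η / 2 * t ^ 2 - |t| + 1 / (2 * η) := by
      rw [← sq_abs t]; field_simp; ring
    linarith
  rw [airyIntegrand, norm_mul, norm_airyExp, airyConst]
  calc _ ≤ (k.factorial * Real.exp (|t| + η)) * Real.exp (-(η * t ^ 2) + η ^ 3 / 3 - x * η) := by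
        gcongr; exact h1.trans h2
    _ = k.factorial * Real.exp (|t| + η - (η * t ^ 2) + η ^ 3 / 3 - x * η) := by
        rw [mul_assoc, ← Real.exp_add]; ring_nf
    _ ≤ k.factorial * Real.exp (η + 1 / (2 * η) + η ^ 3 / 3 + -(η * x) + -(η / 2) * t ^ 2) := by
        gcongr; linarith
    _ = _ := by rw [Real.exp_add, Real.exp_add]; ring

lemma integrable_airyIntegrand (k : ℕ) {η : ℝ} (hη : 0 < η) (x : ℝ) :
    Integrable (airyIntegrand k η x) :=
  ((integrable_exp_neg_mul_sq (half_pos hη)).const_mul _).mono'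
    (continuous_airyIntegrand k η x).aestronglyMeasurable
    (Eventually.of_forall fun t => norm_airyIntegrand_le k hη x t)

/-- The contour integral for the `k`-th derivative of the Airy function, along the line of
height `η`. -/
noncomputable def airyJ (k : ℕ) (η x : ℝ) : ℂ := (1 / (2 * Real.pi) : ℝ) * ∫ t, airyIntegrand k η x t

lemma exists_norm_airyJ_le (k : ℕ) {η : ℝ} (hη : 0 < η) :
    ∃ C, ∀ x, ‖airyJ k η x‖ ≤ C * Real.exp (-(η * x)) := by
  refine ⟨1 / (2 * Real.pi) * (airyConst k η * ∫ t : ℝ, Real.exp (-(η / 2) * t ^ 2)), fun x => ?_⟩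
  rw [airyJ, norm_mul, Complex.norm_real, Real.norm_of_nonneg (by positivity), mul_assoc]
  gcongr
  calc _ ≤ ∫ t, airyConst k η * Real.exp (-(η * x)) * Real.exp (-(η / 2) * t ^ 2) :=
        norm_integral_le_of_norm_le ((integrable_exp_neg_mul_sq (half_pos hη)).const_mul _)
          (Eventually.of_forall fun t => norm_airyIntegrand_le k hη x t)
    _ = _ := by rw [integral_const_mul]; ring

lemma hasDerivAt_airyIntegrand (k : ℕ) (η x t : ℝ) :
    HasDerivAt (fun s => airyIntegrand k η s t) (airyIntegrand (k + 1) η x t) x := by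
  have h : HasDerivAt (fun s : ℝ => Complex.I * ((t + η * Complex.I) ^ 3 / 3
      + (s : ℂ) * (t + η * Complex.I))) (Complex.I * (t + η * Complex.I)) x := by
    simpa using ((Complex.ofRealCLM.hasDerivAt (x := x)).mul_const
      ((t : ℂ) + η * Complex.I)).const_add ((t + η * Complex.I) ^ 3 / 3) |>.const_mul Complex.I
  have := h.cexp.const_mul ((Complex.I * (t + η * Complex.I)) ^ k)
  refine this.congr_deriv ?_
  simp only [airyIntegrand, airyExp]; ring

lemma hasDerivAt_airyJ (k : ℕ) {η : ℝ} (hη : 0 < η) (x : ℝ) :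
    HasDerivAt (airyJ k η) (airyJ (k + 1) η x) x := by
  refine HasDerivAt.const_mul _ ?_
  refine (hasDerivAt_integral_of_dominated_loc_of_deriv_le
    (bound := fun t => airyConst (k + 1) η * Real.exp (-(η * (x - 1)))
      * Real.exp (-(η / 2) * t ^ 2)) (F := airyIntegrand k η) (F' := airyIntegrand (k + 1) η)
    (s := Metric.ball x 1) (Metric.ball_mem_nhds x one_pos) ?_ ?_ ?_ ?_ ?_ ?_).2
  · exact Eventually.of_forall fun s => (continuous_airyIntegrand k η s).aestronglyMeasurable
  · exact integrable_airyIntegrand k hη x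
  · exact (continuous_airyIntegrand (k + 1) η x).aestronglyMeasurable
  · refine Eventually.of_forall fun t s hs => (norm_airyIntegrand_le (k + 1) hη s t).trans ?_
    have := airyConst_nonneg (k + 1) η
    have hs' : x - 1 ≤ s := by
      rw [Metric.mem_ball, Real.dist_eq, abs_lt] at hs; linarith
    gcongr
  · exact (integrable_exp_neg_mul_sq (half_pos hη)).const_mul _
  · exact Eventually.of_forall fun t s _ => hasDerivAt_airyIntegrand k η s t

lemma tendsto_exp_neg_mul_sq {b : ℝ} (hb : 0 < b) :
    Tendsto (fun t : ℝ => Real.exp (-b * t ^ 2)) (cocompact ℝ) (nhds 0) := by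
  refine Real.tendsto_exp_atBot.comp ?_
  have h : Tendsto (fun t : ℝ => |t| ^ 2) (cocompact ℝ) atTop :=
    (tendsto_pow_atTop two_ne_zero).comp (tendsto_norm_cocompact_atTop (E := ℝ))
  refine (tendsto_neg_atTop_atBot.comp (h.const_mul_atTop hb)).congr fun t => ?_
  simp

/-- Airy's equation: with `z = t + iη`, the difference of the two integrands is, up to the factor
`-i`, the `t`-derivative of `exp (i (z³/3 + x z))`, which vanishes at both ends. -/
lemma airyJ_two {η : ℝ} (hη : 0 < η) (x : ℝ) : airyJ 2 η x = x * airyJ 0 η x := by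
  have hd : ∀ t : ℝ, HasDerivAt (airyIntegrand 0 η x)
      (-Complex.I * (airyIntegrand 2 η x t - x * airyIntegrand 0 η x t)) t := by
    intro t
    have hz : HasDerivAt (fun s : ℝ => (s : ℂ) + η * Complex.I) 1 t := by
      simpa using (Complex.ofRealCLM.hasDerivAt (x := t)).add_const ((η : ℂ) * Complex.I)
    have h := ((((hz.pow 3).div_const 3).add (hz.const_mul (x : ℂ))).const_mul Complex.I).cexp
    have e : airyIntegrand 0 η x = fun s : ℝ => Complex.exp (Complex.I *
        (((s : ℂ) + η * Complex.I) ^ 3 / 3 + x * (s + η * Complex.I))) := by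
      funext s; simp [airyIntegrand, airyExp]
    rw [e]
    refine h.congr_deriv ?_
    simp only [airyIntegrand, airyExp, Pi.add_apply, Pi.pow_apply]
    generalize Complex.exp (Complex.I * (((t : ℂ) + η * Complex.I) ^ 3 / 3
      + x * (t + η * Complex.I))) = w
    generalize (t : ℂ) + η * Complex.I = z
    push_cast
    linear_combination (w * Complex.I * z ^ 2) * Complex.I_sq
  have hz : ∀ l ≤ cocompact ℝ, Tendsto (airyIntegrand 0 η x) l (nhds 0) := fun l hl => by
    refine squeeze_zero_norm (fun t => norm_airyIntegrand_le 0 hη x t) ?_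
    simpa using ((tendsto_exp_neg_mul_sq (half_pos hη)).mono_left hl).const_mul
      (airyConst 0 η * Real.exp (-(η * x)))
  have hi := (integrable_airyIntegrand 2 hη x).sub
    ((integrable_airyIntegrand 0 hη x).const_mul (x : ℂ))
  have := integral_of_hasDerivAt_of_tendsto hd (hi.const_mul (-Complex.I))
    (hz atBot atBot_le_cocompact) (hz atTop atTop_le_cocompact)
  rw [integral_const_mul, sub_zero, mul_eq_zero] at this
  have h2 := this.resolve_left (by simp)
  rw [integral_sub (integrable_airyIntegrand 2 hη x)
    ((integrable_airyIntegrand 0 hη x).const_mul _), integral_const_mul, sub_eq_zero] at h2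
  rw [airyJ, airyJ, h2]; ring

/-- These are the vertical sides of the rectangle used to shift the contour; `s R` stands for `R` or
`-R`. The decay `exp (-y R²)` is not uniform near `y = 0`, hence dominated convergence instead of a
supremum bound. -/
lemma tendsto_integral_airyExp_vertical (x : ℝ) {η : ℝ} (hη : 0 < η) (s : ℝ → ℝ)
    (hs : ∀ R, s R ^ 2 = R ^ 2) :
    Tendsto (fun R : ℝ => ∫ y in (0 : ℝ)..η, airyExp x (s R + y * Complex.I)) atTop (nhds 0) := by
  have h0 : (0 : ℂ) = ∫ y in (0 : ℝ)..η, (0 : ℂ) := by simp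
  have hb : ∀ R y : ℝ, y ∈ Ioc 0 η → ‖airyExp x (s R + y * Complex.I)‖
      ≤ Real.exp (η ^ 3 / 3 + |x| * η) * Real.exp (-y * R ^ 2) := by
    intro R y hy
    rw [norm_airyExp, ← Real.exp_add, hs]
    have h1 : y ^ 3 ≤ η ^ 3 := pow_le_pow_left₀ hy.1.le hy.2 3
    have h2 : -(x * y) ≤ |x| * η := by
      calc -(x * y) ≤ |x * y| := neg_le_abs _
        _ = |x| * y := by rw [abs_mul, abs_of_pos hy.1]
        _ ≤ |x| * η := by gcongr; exact hy.2
    exact Real.exp_le_exp.2 (by linarith)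
  rw [h0]
  refine intervalIntegral.tendsto_integral_filter_of_dominated_convergence
    (fun _ => Real.exp (η ^ 3 / 3 + |x| * η)) ?_ ?_ ?_ ?_
  · refine Eventually.of_forall fun R => Continuous.aestronglyMeasurable ?_
    exact (differentiable_airyExp x).continuous.comp (by fun_prop)
  · refine Eventually.of_forall fun R => Eventually.of_forall fun y hy => ?_
    rw [uIoc_of_le hη.le] at hy
    refine (hb R y hy).trans (mul_le_of_le_one_right (Real.exp_nonneg _) ?_)
    exact Real.exp_le_one_iff.2 (by nlinarith [hy.1, sq_nonneg R])
  · simp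
  · refine Eventually.of_forall fun y hy => ?_
    rw [uIoc_of_le hη.le] at hy
    refine squeeze_zero_norm (fun R => hb R y hy) ?_
    simpa using ((tendsto_exp_neg_mul_sq hy.1).mono_left atTop_le_cocompact).const_mul
      (Real.exp (η ^ 3 / 3 + |x| * η))

lemma integral_airyExp_symm (x R : ℝ) :
    ∫ t in (-R)..R, airyExp x t
      = ((2 * ∫ t in (0 : ℝ)..R, Real.cos (t ^ 3 / 3 + x * t) : ℝ) : ℂ) := by
  have hc : Continuous fun t : ℝ => airyExp x t :=
    (differentiable_airyExp x).continuous.comp Complex.continuous_ofReal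
  have hi : ∀ a b : ℝ, IntervalIntegrable (fun t : ℝ => airyExp x t) volume a b :=
    fun a b => hc.intervalIntegrable a b
  have hi' : IntervalIntegrable (fun t : ℝ => airyExp x ((-t : ℝ) : ℂ)) volume 0 R :=
    (hc.comp continuous_neg).intervalIntegrable 0 R
  have hneg : ∫ t in (0 : ℝ)..R, airyExp x ((-t : ℝ) : ℂ) = ∫ t in (-R)..0, airyExp x t := by
    rw [intervalIntegral.integral_comp_neg (fun t : ℝ => airyExp x t), neg_zero]
  rw [← intervalIntegral.integral_add_adjacent_intervals (hi (-R) 0) (hi 0 R), ← hneg,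
    ← intervalIntegral.integral_add hi' (hi 0 R), ← intervalIntegral.integral_const_mul,
    ← intervalIntegral.integral_ofReal]
  refine intervalIntegral.integral_congr fun t _ => ?_
  have e1 : airyExp x (t : ℂ) = Complex.exp (((t ^ 3 / 3 + x * t : ℝ) : ℂ) * Complex.I) := by
    rw [airyExp]; push_cast; ring_nf
  have e2 : airyExp x ((-t : ℝ) : ℂ)
      = Complex.exp (-((t ^ 3 / 3 + x * t : ℝ) : ℂ) * Complex.I) := by
    rw [airyExp]; push_cast; ring_nf
  simp only [e1, e2]
  rw [Complex.ofReal_mul, Complex.ofReal_cos, Complex.ofReal_ofNat, Complex.two_cos, add_comm]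

/-- The Airy function equals its absolutely convergent contour integral. -/
lemma airyAi_eq_airyJ {η : ℝ} (hη : 0 < η) (x : ℝ) : (airyAi x : ℂ) = airyJ 0 η x := by
  -- Cauchy's theorem on the rectangle with base `[-R, R]` and height `η`.
  have hrect : ∀ R : ℝ, ∫ t in (-R)..R, airyExp x t = (∫ t in (-R)..R, airyIntegrand 0 η x t)
      - Complex.I * (∫ y in (0 : ℝ)..η, airyExp x (R + y * Complex.I))
      + Complex.I * ∫ y in (0 : ℝ)..η, airyExp x ((-R : ℝ) + y * Complex.I) := by
    intro R
    have h := Complex.integral_boundary_rect_eq_zero_of_differentiableOn (airyExp x)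
      ((-R : ℝ) : ℂ) (R + η * Complex.I) (differentiable_airyExp x).differentiableOn
    simp at h
    simp only [airyIntegrand, pow_zero, one_mul]
    push_cast
    linear_combination h
  have hlim : Tendsto (fun R : ℝ => ∫ t in (-R)..R, airyExp x t) atTop
      (nhds (∫ t, airyIntegrand 0 η x t)) := by
    simp_rw [hrect]
    have h1 := intervalIntegral_tendsto_integral (integrable_airyIntegrand 0 hη x)
      tendsto_neg_atTop_atBot tendsto_id
    have h2 := tendsto_integral_airyExp_vertical x hη (fun R => R) (fun _ => rfl)
    have h3 := tendsto_integral_airyExp_vertical x hη (fun R => -R) (fun _ => neg_sq _)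
    simpa using (h1.sub (h2.const_mul Complex.I)).add (h3.const_mul Complex.I)
  have hlim2 : Tendsto (fun R : ℝ => (((1 / Real.pi) * ∫ t in (0 : ℝ)..R,
      Real.cos (t ^ 3 / 3 + x * t) : ℝ) : ℂ)) atTop (nhds (airyJ 0 η x)) := by
    refine (hlim.const_mul (((1 / (2 * Real.pi) : ℝ) : ℂ))).congr fun R => ?_
    rw [integral_airyExp_symm, ← Complex.ofReal_mul]
    congr 1
    field_simp
  have hre := (Complex.continuous_re.tendsto _).comp hlim2
  have him := (Complex.continuous_im.tendsto _).comp hlim2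
  have him0 : (airyJ 0 η x).im = 0 :=
    tendsto_nhds_unique him (tendsto_const_nhds.congr fun R => by simp)
  have hAi : airyAi x = (airyJ 0 η x).re := by
    refine Tendsto.limUnder_eq (hre.congr fun R => ?_)
    simp only [Function.comp, Complex.ofReal_re]
  apply Complex.ext <;> simp [hAi, him0]

/-- The `k`-th derivative of the Airy function. -/
noncomputable def airyDeriv (k : ℕ) (x : ℝ) : ℝ := (airyJ k 1 x).re

lemma airyDeriv_zero : airyDeriv 0 = airyAi := by
  funext x
  rw [airyDeriv, ← airyAi_eq_airyJ one_pos, Complex.ofReal_re]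

lemma hasDerivAt_airyDeriv (k : ℕ) (x : ℝ) : HasDerivAt (airyDeriv k) (airyDeriv (k + 1) x) x :=
  Complex.reCLM.hasFDerivAt.comp_hasDerivAt x (hasDerivAt_airyJ k one_pos x)

lemma continuous_airyDeriv (k : ℕ) : Continuous (airyDeriv k) :=
  continuous_iff_continuousAt.2 fun x => (hasDerivAt_airyDeriv k x).continuousAt

lemma airyDeriv_two (x : ℝ) : airyDeriv 2 x = x * airyDeriv 0 x := by
  rw [airyDeriv, airyJ_two one_pos, Complex.re_ofReal_mul, airyDeriv]

/-- For `k = 0` every height gives `Ai` itself; differentiating carries the independence of `η` to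
all `k`. Freedom in `η` is what yields decay at every exponential rate. -/
lemma airyDeriv_eq_re (k : ℕ) {η : ℝ} (hη : 0 < η) : airyDeriv k = fun x => (airyJ k η x).re := by
  induction k with
  | zero => funext x; rw [airyDeriv, ← airyAi_eq_airyJ one_pos, ← airyAi_eq_airyJ hη]
  | succ k ih =>
    funext x
    have h1 := hasDerivAt_airyDeriv k x
    rw [ih] at h1
    exact h1.unique (Complex.reCLM.hasFDerivAt.comp_hasDerivAt x (hasDerivAt_airyJ k hη x))

/-- The derivatives of the Airy function decay faster than every exponential. -/
lemma exists_abs_airyDeriv_le (k : ℕ) {η : ℝ} (hη : 0 < η) :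
    ∃ C, 0 ≤ C ∧ ∀ x, |airyDeriv k x| ≤ C * Real.exp (-(η * x)) := by
  obtain ⟨C, hC⟩ := exists_norm_airyJ_le k hη
  have hC0 : 0 ≤ C := by simpa using (norm_nonneg _).trans (hC 0)
  refine ⟨C, hC0, fun x => ?_⟩
  rw [airyDeriv_eq_re k hη]
  exact (Complex.abs_re_le_norm _).trans (hC x)

/-- Up to nonzero factors, the values of `Ai` are those of the Fourier transform of `t ↦
airyIntegrand 0 1 0 t`. Were they all zero, Fourier inversion would make this function vanish, but
it is an exponential. -/
lemma exists_airyAi_ne_zero : ∃ x, airyDeriv 0 x ≠ 0 := by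
  by_contra! h
  set g : ℝ → ℂ := fun t => airyIntegrand 0 1 0 t with hg
  have hint : Integrable g := integrable_airyIntegrand 0 one_pos 0
  have hJ : ∀ x, airyJ 0 1 x = 0 := fun x => by
    rw [← airyAi_eq_airyJ one_pos, ← airyDeriv_zero, h, Complex.ofReal_zero]
  have hF : FourierTransform.fourier g = 0 := by
    funext ξ
    rw [Real.fourier_eq']
    have h1 := hJ (-2 * Real.pi * ξ)
    rw [airyJ, mul_eq_zero] at h1
    have h2 := h1.resolve_left (Complex.ofReal_ne_zero.2 (by positivity))
    have e : ∀ t : ℝ, Complex.exp (↑(-2 * Real.pi * inner ℝ t ξ) * Complex.I) • g t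
        = Complex.exp (-2 * Real.pi * ξ) * airyIntegrand 0 1 (-2 * Real.pi * ξ) t := by
      intro t
      simp only [hg, airyIntegrand, airyExp, pow_zero, one_mul, smul_eq_mul, ← Complex.exp_add]
      congr 1
      simp only [RCLike.inner_apply, conj_trivial]
      push_cast
      linear_combination (2 * Real.pi * ξ : ℂ) * Complex.I_sq
    simp_rw [e, integral_const_mul, h2, mul_zero]
    rfl
  have hinv := (show Continuous g from continuous_airyIntegrand 0 1 0).fourierInv_fourier_eq hint
    (by rw [hF]; exact integrable_zero _ _ _)
  rw [hF] at hinv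
  have h0 : g 0 = 0 := by
    rw [← hinv]
    simp [Real.fourierInv_eq']
  simp [hg, airyIntegrand, airyExp] at h0

/-- The Airy function and its derivative have no common zero. -/
lemma airyDeriv_zero_ne_zero_or (z : ℝ) : airyDeriv 0 z ≠ 0 ∨ airyDeriv 1 z ≠ 0 := by
  by_contra! h
  obtain ⟨x, hx⟩ := exists_airyAi_ne_zero
  -- Grönwall argument: by Airy's equation `E' = 2 (1 + s) Ai Ai'`, so `|E'| ≤ M E` between `z` and
  -- `x`, and `E z = 0` would force `E x = 0`. The two cases of `z ≤ x` and `x ≤ z` use the weights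
  -- `exp (-M s)` and `exp (M s)`.
  set E : ℝ → ℝ := fun s => airyDeriv 0 s ^ 2 + airyDeriv 1 s ^ 2 with hE
  set M : ℝ := |z| + |x| + 1 with hM
  have hEd : ∀ s, HasDerivAt E (2 * (1 + s) * (airyDeriv 0 s * airyDeriv 1 s)) s := fun s => by
    refine (((hasDerivAt_airyDeriv 0 s).pow 2).add ((hasDerivAt_airyDeriv 1 s).pow 2)).congr_deriv ?_
    rw [show (1 + 1 : ℕ) = 2 from rfl, airyDeriv_two]; push_cast; ring
  have hEz : E z = 0 := by simp [hE, h.1, h.2]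
  have hExp : 0 < E x := by positivity
  have hbd : ∀ s, |s| ≤ |z| + |x| → |2 * (1 + s) * (airyDeriv 0 s * airyDeriv 1 s)| ≤ M * E s := by
    intro s hs
    have h1 : |1 + s| ≤ M := (abs_add_le 1 s).trans (by rw [abs_one]; linarith)
    have h2 : 2 * |airyDeriv 0 s * airyDeriv 1 s| ≤ E s := by
      rw [abs_mul, ← mul_assoc]
      simpa only [hE, sq_abs] using two_mul_le_add_sq |airyDeriv 0 s| |airyDeriv 1 s|
    calc _ = |1 + s| * (2 * |airyDeriv 0 s * airyDeriv 1 s|) := by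
          rw [abs_mul, abs_mul, abs_two]; ring
      _ ≤ M * E s := by gcongr
  have hseg : ∀ s ∈ uIcc z x, |s| ≤ |z| + |x| := fun s hs => by
    have h2 := abs_le_max_abs_abs (uIcc_subset_Icc (a₂ := min z x) (b₂ := max z x)
      ⟨min_le_left _ _, le_max_left _ _⟩ ⟨min_le_right _ _, le_max_right _ _⟩ hs).1
      (uIcc_subset_Icc (a₂ := min z x) (b₂ := max z x)
      ⟨min_le_left _ _, le_max_left _ _⟩ ⟨min_le_right _ _, le_max_right _ _⟩ hs).2
    refine h2.trans (max_le ?_ ?_)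
    · rcases min_choice z x with e | e <;> rw [e] <;> linarith [abs_nonneg z, abs_nonneg x]
    · rcases max_choice z x with e | e <;> rw [e] <;> linarith [abs_nonneg z, abs_nonneg x]
  have hexp : ∀ (a s : ℝ), HasDerivAt (fun s => E s * Real.exp (a * s))
      ((2 * (1 + s) * (airyDeriv 0 s * airyDeriv 1 s) + a * E s) * Real.exp (a * s)) s :=
    fun a s => by
      refine ((hEd s).mul (((hasDerivAt_id s).const_mul a).exp)).congr_deriv ?_
      simp only [id]; ring
  rcases le_total z x with hzx | hzx
  · rw [uIcc_of_le hzx] at hseg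
    have hanti : AntitoneOn (fun s => E s * Real.exp (-M * s)) (Icc z x) := by
      refine antitoneOn_of_hasDerivWithinAt_nonpos (convex_Icc z x)
        (fun s _ => (hexp (-M) s).continuousAt.continuousWithinAt)
        (fun s _ => (hexp (-M) s).hasDerivWithinAt) fun s hs => ?_
      rw [interior_Icc] at hs
      have := le_of_abs_le (hbd s (hseg s (Ioo_subset_Icc_self hs)))
      exact mul_nonpos_of_nonpos_of_nonneg (by linarith) (Real.exp_nonneg _)
    have := hanti (left_mem_Icc.2 hzx) (right_mem_Icc.2 hzx) hzx
    simp only [hEz, zero_mul] at this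
    exact absurd this (not_le.2 (by positivity))
  · rw [uIcc_of_ge hzx] at hseg
    have hmono : MonotoneOn (fun s => E s * Real.exp (M * s)) (Icc x z) := by
      refine monotoneOn_of_hasDerivWithinAt_nonneg (convex_Icc x z)
        (fun s _ => (hexp M s).continuousAt.continuousWithinAt)
        (fun s _ => (hexp M s).hasDerivWithinAt) fun s hs => ?_
      rw [interior_Icc] at hs
      have := neg_le_of_abs_le (hbd s (hseg s (Ioo_subset_Icc_self hs)))
      exact mul_nonneg (by linarith) (Real.exp_nonneg _)
    have := hmono (left_mem_Icc.2 hzx) (right_mem_Icc.2 hzx) hzx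
    simp only [hEz, zero_mul] at this
    exact absurd this (not_le.2 (by positivity))

/-! ### Hankel operators with exponentially decaying kernels -/

/-- A continuous function bounded by a multiple of `exp (-κ z)`. -/
structure IsExpKernel (κ : ℝ) (a : ℝ → ℝ) : Prop where
  continuous : Continuous a
  bound : ∃ C, 0 ≤ C ∧ ∀ z, |a z| ≤ C * Real.exp (-(κ * z))

/-- The Hankel integral operator on `[0, ∞)` with kernel `a (x + y)`. -/
noncomputable def hankel (a f : ℝ → ℝ) (x : ℝ) : ℝ := ∫ y in Ioi (0 : ℝ), a (x + y) * f y

lemma IsExpKernel.const_mul {κ : ℝ} {a : ℝ → ℝ} (ha : IsExpKernel κ a) (r : ℝ) :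
    IsExpKernel κ fun z => r * a z := by
  obtain ⟨C, hC, h⟩ := ha.bound
  refine ⟨continuous_const.mul ha.continuous, |r| * C, by positivity, fun z => ?_⟩
  rw [abs_mul, mul_assoc]
  gcongr
  exact h z

lemma IsExpKernel.add {κ : ℝ} {a b : ℝ → ℝ} (ha : IsExpKernel κ a) (hb : IsExpKernel κ b) :
    IsExpKernel κ fun z => a z + b z := by
  obtain ⟨C, hC, h⟩ := ha.bound
  obtain ⟨D, hD, h'⟩ := hb.bound
  refine ⟨ha.continuous.add hb.continuous, C + D, by positivity, fun z => ?_⟩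
  rw [add_mul]
  exact (abs_add_le _ _).trans (add_le_add (h z) (h' z))

lemma IsExpKernel.comp_add {κ : ℝ} {a : ℝ → ℝ} (ha : IsExpKernel κ a) (c : ℝ) :
    IsExpKernel κ fun z => a (z + c) := by
  obtain ⟨C, hC, h⟩ := ha.bound
  refine ⟨ha.continuous.comp (continuous_id.add continuous_const), C * Real.exp (-(κ * c)),
    by positivity, fun z => (h _).trans_eq ?_⟩
  rw [mul_assoc, ← Real.exp_add]; ring_nf

lemma IsExpKernel.tendsto_atTop {κ : ℝ} (hκ : 0 < κ) {a : ℝ → ℝ} (ha : IsExpKernel κ a) :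
    Tendsto a atTop (nhds 0) := by
  obtain ⟨C, hC, h⟩ := ha.bound
  refine squeeze_zero_norm h ?_
  have : Tendsto (fun z : ℝ => Real.exp (-(κ * z))) atTop (nhds 0) :=
    Real.tendsto_exp_neg_atTop_nhds_zero.comp (tendsto_id.const_mul_atTop hκ)
  simpa using this.const_mul C

lemma integrableOn_exp_neg_mul {κ : ℝ} (hκ : 0 < κ) :
    IntegrableOn (fun y : ℝ => Real.exp (-(κ * y))) (Ioi 0) := by
  simpa [neg_mul] using exp_neg_integrableOn_Ioi 0 hκ

lemma IsExpKernel.memLp {a : ℝ → ℝ} {κ : ℝ} (hκ : 0 < κ) (ha : IsExpKernel κ a) :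
    MemLp a 2 (volume.restrict (Ioi (0 : ℝ))) := by
  obtain ⟨C, hC, h⟩ := ha.bound
  rw [memLp_two_iff_integrable_sq ha.continuous.aestronglyMeasurable]
  refine ((integrableOn_exp_neg_mul (κ := 2 * κ) (by positivity)).const_mul (C ^ 2)).mono'
    (ha.continuous.pow 2).aestronglyMeasurable (Eventually.of_forall fun y => ?_)
  calc ‖a y ^ 2‖ = |a y| ^ 2 := by rw [norm_pow, Real.norm_eq_abs]
    _ ≤ (C * Real.exp (-(κ * y))) ^ 2 := by gcongr; exact h y
    _ = _ := by rw [mul_pow, ← Real.exp_nat_mul]; push_cast; ring_nf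

lemma IsExpKernel.integrable_mul {a b : ℝ → ℝ} (ha : IsExpKernel 1 a) (hb : IsExpKernel 1 b) :
    IntegrableOn (fun x => a x * b x) (Ioi 0) :=
  (ha.memLp one_pos).integrable_mul (hb.memLp one_pos)

lemma isExpKernel_exp (κ : ℝ) : IsExpKernel κ fun z => Real.exp (-(κ * z)) :=
  ⟨by fun_prop, 1, zero_le_one, fun z => by rw [Real.abs_exp, one_mul]⟩

lemma MeasureTheory.MemLp.integrable_exp_mul {f : ℝ → ℝ}
    (hf : MemLp f 2 (volume.restrict (Ioi (0 : ℝ)))) {κ : ℝ} (hκ : 0 < κ) :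
    IntegrableOn (fun y => Real.exp (-(κ * y)) * f y) (Ioi 0) :=
  ((isExpKernel_exp κ).memLp hκ).integrable_mul hf

lemma aestronglyMeasurable_of_integrable_exp_mul {κ : ℝ} {f : ℝ → ℝ} {μ : Measure ℝ}
    (hf : Integrable (fun y => Real.exp (-(κ * y)) * f y) μ) : AEStronglyMeasurable f μ := by
  have h := (show Continuous fun y : ℝ => Real.exp (κ * y) by fun_prop).aestronglyMeasurable.mul
    hf.aestronglyMeasurable
  refine h.congr (Eventually.of_forall fun y => ?_)
  simp [← mul_assoc, ← Real.exp_add]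

section
variable {κ : ℝ} {a a' f g : ℝ → ℝ}

lemma IsExpKernel.integrable_mul_of_exp {μ : Measure ℝ} (ha : IsExpKernel κ a)
    (hf : Integrable (fun y => Real.exp (-(κ * y)) * f y) μ) :
    Integrable (fun y => a y * f y) μ := by
  obtain ⟨C, hC, h⟩ := ha.bound
  refine (hf.norm.const_mul C).mono' (ha.continuous.aestronglyMeasurable.mul
    (aestronglyMeasurable_of_integrable_exp_mul hf)) (Eventually.of_forall fun y => ?_)
  rw [norm_mul, norm_mul, Real.norm_eq_abs (a y), Real.norm_of_nonneg (Real.exp_nonneg _),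
    ← mul_assoc]
  gcongr
  exact h y

lemma IsExpKernel.integrable_hankel (ha : IsExpKernel κ a)
    (hf : IntegrableOn (fun y => Real.exp (-(κ * y)) * f y) (Ioi 0)) (x : ℝ) :
    IntegrableOn (fun y => a (x + y) * f y) (Ioi 0) := by
  have := (ha.comp_add x).integrable_mul_of_exp hf
  simpa only [IntegrableOn, add_comm x] using this

lemma IsExpKernel.hasDerivAt_hankel (hκ : 0 ≤ κ) (ha : IsExpKernel κ a) (ha' : IsExpKernel κ a')
    (hd : ∀ z, HasDerivAt a (a' z) z)
    (hf : IntegrableOn (fun y => Real.exp (-(κ * y)) * f y) (Ioi 0)) (x : ℝ) :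
    HasDerivAt (hankel a f) (hankel a' f x) x := by
  obtain ⟨C, hC, h⟩ := ha'.bound
  refine (hasDerivAt_integral_of_dominated_loc_of_deriv_le
    (F := fun x y => a (x + y) * f y) (F' := fun x y => a' (x + y) * f y)
    (bound := fun y => C * Real.exp (-(κ * (x - 1))) * ‖Real.exp (-(κ * y)) * f y‖)
    (s := Metric.ball x 1) (Metric.ball_mem_nhds x one_pos) ?_ ?_ ?_ ?_ ?_ ?_).2
  · exact Eventually.of_forall fun s => (ha.integrable_hankel hf s).aestronglyMeasurable
  · exact ha.integrable_hankel hf x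
  · exact (ha'.integrable_hankel hf x).aestronglyMeasurable
  · refine Eventually.of_forall fun y s hs => ?_
    have hs' : x - 1 ≤ s := by
      rw [Metric.mem_ball, Real.dist_eq, abs_lt] at hs; linarith
    rw [norm_mul, norm_mul, Real.norm_of_nonneg (Real.exp_nonneg _), ← mul_assoc]
    refine mul_le_mul_of_nonneg_right ((h (s + y)).trans ?_) (norm_nonneg _)
    rw [mul_assoc, ← Real.exp_add]
    gcongr
    nlinarith
  · exact hf.norm.const_mul _
  · refine Eventually.of_forall fun y s _ => ?_
    simpa using ((hd (s + y)).comp_add_const s y).mul_const (f y)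

lemma IsExpKernel.hankel_bound (ha : IsExpKernel κ a)
    (hf : IntegrableOn (fun y => Real.exp (-(κ * y)) * f y) (Ioi 0)) :
    ∃ C, 0 ≤ C ∧ ∀ z, |hankel a f z| ≤ C * Real.exp (-(κ * z)) := by
  obtain ⟨C, hC, h⟩ := ha.bound
  refine ⟨C * ∫ y in Ioi (0 : ℝ), ‖Real.exp (-(κ * y)) * f y‖, by positivity, fun z => ?_⟩
  rw [hankel, mul_right_comm, ← integral_const_mul, ← Real.norm_eq_abs]
  refine norm_integral_le_of_norm_le (hf.norm.const_mul _) (Eventually.of_forall fun y => ?_)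
  rw [norm_mul, norm_mul, Real.norm_of_nonneg (Real.exp_nonneg _), ← mul_assoc]
  refine mul_le_mul_of_nonneg_right ((h (z + y)).trans_eq ?_) (norm_nonneg _)
  rw [mul_assoc, ← Real.exp_add]; ring_nf

lemma IsExpKernel.integral_hankel_mul (ha : IsExpKernel κ a)
    (hf : IntegrableOn (fun y => Real.exp (-(κ * y)) * f y) (Ioi 0))
    (hg : IntegrableOn (fun y => Real.exp (-(κ * y)) * g y) (Ioi 0)) :
    ∫ x in Ioi (0 : ℝ), hankel a f x * g x = ∫ x in Ioi (0 : ℝ), f x * hankel a g x := by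
  obtain ⟨C, hC, h⟩ := ha.bound
  have hfm := aestronglyMeasurable_of_integrable_exp_mul hf
  have hgm := aestronglyMeasurable_of_integrable_exp_mul hg
  have hint : Integrable (Function.uncurry fun x y => a (x + y) * f y * g x)
      ((volume.restrict (Ioi (0 : ℝ))).prod (volume.restrict (Ioi (0 : ℝ)))) := by
    refine ((hg.mul_prod hf).norm.const_mul C).mono' ?_ (Eventually.of_forall fun p => ?_)
    · exact ((ha.continuous.comp (continuous_fst.add continuous_snd)).aestronglyMeasurable.mul
        hfm.comp_snd).mul hgm.comp_fst
    · simp only [Function.uncurry, norm_mul]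
      rw [Real.norm_of_nonneg (Real.exp_nonneg _), Real.norm_of_nonneg (Real.exp_nonneg _)]
      calc _ ≤ C * Real.exp (-(κ * (p.1 + p.2))) * ‖f p.2‖ * ‖g p.1‖ := by gcongr; exact h _
        _ = _ := by rw [mul_add, neg_add, Real.exp_add]; ring
  calc _ = ∫ x in Ioi (0 : ℝ), ∫ y in Ioi (0 : ℝ), a (x + y) * f y * g x := by
        simp only [hankel, integral_mul_const]
    _ = ∫ y in Ioi (0 : ℝ), ∫ x in Ioi (0 : ℝ), a (x + y) * f y * g x := integral_integral_swap hint
    _ = _ := by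
        refine integral_congr_ae (Eventually.of_forall fun y => ?_)
        simp only [hankel, ← integral_const_mul]
        refine integral_congr_ae (Eventually.of_forall fun x => ?_)
        simp only [add_comm x y]; ring

end

/-- Integration by parts on `[0, ∞)` for exponentially decaying functions. -/
lemma integral_deriv_mul_add_mul_deriv {u u' v v' : ℝ → ℝ} (hu : IsExpKernel 1 u)
    (hu' : IsExpKernel 1 u') (hv : IsExpKernel 1 v) (hv' : IsExpKernel 1 v')
    (hdu : ∀ x, HasDerivAt u (u' x) x) (hdv : ∀ x, HasDerivAt v (v' x) x) :
    (∫ x in Ioi (0 : ℝ), u' x * v x) + ∫ x in Ioi (0 : ℝ), u x * v' x = -(u 0 * v 0) := by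
  rw [← integral_add (hu'.integrable_mul hv) (hu.integrable_mul hv')]
  have := integral_Ioi_of_hasDerivAt_of_tendsto (a := 0) (f := fun x => u x * v x) (m := 0)
    ((hu.continuous.mul hv.continuous).continuousWithinAt)
    (fun x _ => (hdu x).mul (hdv x)) ((hu'.integrable_mul hv).add (hu.integrable_mul hv'))
    (by simpa using (hu.tendsto_atTop one_pos).mul (hv.tendsto_atTop one_pos))
  simpa using this

/-! ### Moments and injectivity of the Airy operator -/

/-- An exponentially decaying function on `[0, ∞)` is determined by its moments. -/
lemma ae_eq_zero_of_moments {g : ℝ → ℝ}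
    (hg : ∀ κ : ℝ, 0 ≤ κ → IntegrableOn (fun y => Real.exp (κ * y) * g y) (Ioi 0))
    (hm : ∀ k : ℕ, ∫ y in Ioi (0 : ℝ), y ^ k * g y = 0) :
    g =ᵐ[volume.restrict (Ioi (0 : ℝ))] 0 := by
  set μ : Measure ℝ := volume.restrict (Ioi (0 : ℝ)) with hμ
  have hgi : Integrable g μ := by simpa [IntegrableOn] using hg 0 le_rfl
  have hpos : ∀ᵐ y ∂μ, 0 < y := ae_restrict_mem measurableSet_Ioi
  -- The exponential series may be integrated term by term, with majorant `exp (|ξ| y) |g y|`, so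
  -- vanishing moments kill the Fourier transform.
  have hchar : ∀ ξ : ℝ, ∫ y, Complex.exp (ξ * y * Complex.I) * g y ∂μ = 0 := by
    intro ξ
    have hs := hasSum_integral_of_dominated_convergence (μ := μ)
      (F := fun (n : ℕ) (y : ℝ) => (((ξ : ℂ) * y * Complex.I) ^ n / n.factorial) * g y)
      (f := fun y => Complex.exp (ξ * y * Complex.I) * g y)
      (fun n y => (|ξ| * y) ^ n / n.factorial * |g y|) ?_ ?_ ?_ ?_ ?_
    · refine hs.unique ?_
      have : ∀ n : ℕ, ∫ y, (((ξ : ℂ) * y * Complex.I) ^ n / n.factorial) * g y ∂μ = 0 := by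
        intro n
        have e : ∀ y : ℝ, (((ξ : ℂ) * y * Complex.I) ^ n / n.factorial) * g y
            = ((ξ : ℂ) * Complex.I) ^ n / n.factorial * ((y ^ n * g y : ℝ) : ℂ) := fun y => by
          push_cast; rw [mul_right_comm, mul_pow]; ring
        simp_rw [e]
        rw [integral_const_mul, integral_complex_ofReal, hm n]; simp
      simp [this, hasSum_zero]
    · intro n
      refine (Continuous.aestronglyMeasurable (by fun_prop)).mul ?_
      exact Complex.continuous_ofReal.comp_aestronglyMeasurable hgi.aestronglyMeasurable
    · intro n
      filter_upwards [hpos] with y hy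
      simp [abs_of_pos hy]
    · filter_upwards with y
      exact (Real.summable_pow_div_factorial _).mul_right _
    · refine (hg |ξ| (abs_nonneg ξ)).norm.congr (Eventually.of_forall fun y => ?_)
      simp only [tsum_mul_right, norm_mul, Real.norm_eq_abs, Real.abs_exp]
      rw [Real.exp_eq_exp_ℝ, NormedSpace.exp_eq_tsum_div]
    · filter_upwards with y
      refine HasSum.mul_right _ ?_
      rw [Complex.exp_eq_exp_ℂ]
      exact NormedSpace.expSeries_div_hasSum_exp _
  have hfin : ∀ h : ℝ → ℝ, Integrable h μ →
      IsFiniteMeasure (μ.withDensity fun y => ENNReal.ofReal (h y)) := fun h hh =>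
    isFiniteMeasure_withDensity_ofReal hh.2
  have hgn : Integrable (fun y => -g y) μ := hgi.neg
  have := hfin g hgi
  have := hfin (fun y => -g y) hgn
  have hcf : ∀ h : ℝ → ℝ, Integrable h μ → ∀ t : ℝ,
      charFun (μ.withDensity fun y => ENNReal.ofReal (h y)) t
        = ∫ y, Complex.exp (t * y * Complex.I) * (max (h y) 0 : ℝ) ∂μ := by
    intro h hh t
    rw [charFun_apply_real, integral_withDensity_eq_integral_toReal_smul₀
      hh.aestronglyMeasurable.aemeasurable.ennreal_ofReal
      (Eventually.of_forall fun _ => ENNReal.ofReal_lt_top)]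
    refine integral_congr_ae (Eventually.of_forall fun y => ?_)
    simp only [ENNReal.toReal_ofReal', Complex.real_smul]
    ring
  -- Positive and negative parts of `g` are densities of finite measures with the same
  -- characteristic function, hence equal.
  have hmeas : (μ.withDensity fun y => ENNReal.ofReal (g y))
      = μ.withDensity fun y => ENNReal.ofReal (-g y) := by
    refine Measure.ext_of_charFun (funext fun t => ?_)
    have hi : ∀ h : ℝ → ℝ, Integrable h μ → Integrable
        (fun y : ℝ => Complex.exp (t * y * Complex.I) * (max (h y) 0 : ℝ)) μ := fun h hh => by
      refine Integrable.bdd_mul (c := 1) hh.pos_part.ofReal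
        (Continuous.aestronglyMeasurable (by fun_prop)) (Eventually.of_forall fun y => ?_)
      rw [← Complex.ofReal_mul, Complex.norm_exp_ofReal_mul_I]
    rw [hcf g hgi, hcf _ hgn, ← sub_eq_zero, ← integral_sub (hi g hgi) (hi _ hgn),
      ← hchar t]
    refine integral_congr_ae (Eventually.of_forall fun y => ?_)
    simp only [← mul_sub, ← Complex.ofReal_sub]
    rcases le_total (g y) 0 with h0 | h0
    · rw [max_eq_right h0, max_eq_left (neg_nonneg.2 h0)]; simp
    · rw [max_eq_left h0, max_eq_right (neg_nonpos.2 h0)]; simp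
  rw [withDensity_eq_iff hgi.aestronglyMeasurable.aemeasurable.ennreal_ofReal
    hgn.aestronglyMeasurable.aemeasurable.ennreal_ofReal hgi.lintegral_lt_top.ne] at hmeas
  filter_upwards [hmeas] with y hy
  rcases lt_trichotomy (g y) 0 with h0 | h0 | h0
  · rw [ENNReal.ofReal_of_nonpos h0.le, eq_comm, ENNReal.ofReal_eq_zero] at hy
    linarith
  · exact h0
  · rw [ENNReal.ofReal_of_nonpos (p := -g y) (by linarith), ENNReal.ofReal_eq_zero] at hy
    linarith

/-- The `k`-th derivative of the kernel function of `T_c`. -/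
noncomputable def airyKernel (c : ℝ) (k : ℕ) (z : ℝ) : ℝ := airyDeriv k (z + c)

lemma isExpKernel_airyKernel (c : ℝ) (k : ℕ) {κ : ℝ} (hκ : 0 < κ) :
    IsExpKernel κ (airyKernel c k) :=
  IsExpKernel.comp_add ⟨continuous_airyDeriv k, exists_abs_airyDeriv_le k hκ⟩ c

lemma hasDerivAt_airyKernel (c : ℝ) (k : ℕ) (z : ℝ) :
    HasDerivAt (airyKernel c k) (airyKernel c (k + 1) z) z :=
  (hasDerivAt_airyDeriv k (z + c)).comp_add_const z c

lemma airyKernel_two (c z : ℝ) : airyKernel c 2 z = (z + c) * airyKernel c 0 z :=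
  airyDeriv_two _

lemma airyOp_eq_hankel (c : ℝ) (f : ℝ → ℝ) : airyOp c f = hankel (airyKernel c 0) f := by
  funext x
  simp only [airyOp, hankel, airyKernel, airyDeriv_zero]

lemma integrable_exp_mul_pow_mul {f : ℝ → ℝ}
    (hf : ∀ κ : ℝ, 0 < κ → IntegrableOn (fun y => Real.exp (-(κ * y)) * f y) (Ioi 0)) (k : ℕ)
    {κ : ℝ} (hκ : 0 < κ) :
    IntegrableOn (fun y => Real.exp (-(κ * y)) * (y ^ k * f y)) (Ioi 0) := by
  have hm : AEStronglyMeasurable f (volume.restrict (Ioi (0 : ℝ))) :=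
    aestronglyMeasurable_of_integrable_exp_mul (hf 1 one_pos)
  refine Integrable.mono' ((hf (κ / 2) (half_pos hκ)).norm.const_mul (k.factorial / (κ / 2) ^ k))
    ((Continuous.aestronglyMeasurable (by fun_prop)).mul
      ((Continuous.aestronglyMeasurable (by fun_prop)).mul hm)) ?_
  filter_upwards [ae_restrict_mem measurableSet_Ioi] with y hy
  have hy : 0 < y := hy
  have h := Real.pow_div_factorial_le_exp (κ / 2 * y) (by positivity) k
  have h2 : y ^ k ≤ k.factorial / (κ / 2) ^ k * Real.exp (κ / 2 * y) := by
    rw [div_le_iff₀ (by positivity), mul_pow] at h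
    rw [div_mul_eq_mul_div, le_div_iff₀ (by positivity)]
    linarith
  simp only [norm_mul, Real.norm_eq_abs, Real.abs_exp, abs_pow, abs_of_pos hy]
  calc _ ≤ Real.exp (-(κ * y)) * (k.factorial / (κ / 2) ^ k * Real.exp (κ / 2 * y) * |f y|) := by
        gcongr
    _ = k.factorial / (κ / 2) ^ k * (Real.exp (-(κ * y)) * Real.exp (κ / 2 * y) * |f y|) := by ring
    _ = _ := by rw [← Real.exp_add]; ring_nf

lemma hasDerivAt_hankel_airyKernel (c : ℝ) (k : ℕ) {f : ℝ → ℝ} {κ : ℝ} (hκ : 0 < κ)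
    (hf : IntegrableOn (fun y => Real.exp (-(κ * y)) * f y) (Ioi 0)) (x : ℝ) :
    HasDerivAt (hankel (airyKernel c k) f) (hankel (airyKernel c (k + 1)) f x) x :=
  (isExpKernel_airyKernel c k hκ).hasDerivAt_hankel hκ.le (isExpKernel_airyKernel c (k + 1) hκ)
    (hasDerivAt_airyKernel c k) hf x

/-- Airy's equation with the argument split as `(x + c) + y`: multiplying `f` by `y` amounts to
applying `d²/dx² - (x + c)` to its transform. -/
lemma hankel_airyKernel_two (c : ℝ) {f : ℝ → ℝ}
    (hf : ∀ κ : ℝ, 0 < κ → IntegrableOn (fun y => Real.exp (-(κ * y)) * f y) (Ioi 0)) (x : ℝ) :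
    hankel (airyKernel c 2) f x
      = (x + c) * hankel (airyKernel c 0) f x + hankel (airyKernel c 0) (fun y => y * f y) x := by
  have hK := isExpKernel_airyKernel c 0 one_pos
  have h1 := hK.integrable_hankel (hf 1 one_pos) x
  have h2 := hK.integrable_hankel (f := fun y => y * f y)
    (by simpa using integrable_exp_mul_pow_mul hf 1 one_pos) x
  simp only [hankel]
  rw [← integral_const_mul, ← integral_add (h1.const_mul _) h2]
  refine integral_congr_ae (Eventually.of_forall fun y => ?_)
  simp only [airyKernel_two]; ring

lemma eq_zero_of_hasDerivAt_of_eqOn_Ici {u u' : ℝ → ℝ} (hd : ∀ x, HasDerivAt u (u' x) x)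
    (hu : ∀ x, 0 ≤ x → u x = 0) : ∀ x, 0 ≤ x → u' x = 0 := fun x hx =>
  (uniqueDiffWithinAt_Ici x).eq_deriv _ (hd x).hasDerivWithinAt
    ((hasDerivWithinAt_const x (Ici x) (0 : ℝ)).congr
      (fun y hy => hu y (hx.trans hy)) (hu x hx))

/-- The operator `T_c` is injective. -/
theorem ae_eq_zero_of_airyOp_eq_zero {c : ℝ} {f : ℝ → ℝ}
    (hf : MemLp f 2 (volume.restrict (Ioi (0 : ℝ)))) (h0 : ∀ x, 0 ≤ x → airyOp c f x = 0) :
    f =ᵐ[volume.restrict (Ioi (0 : ℝ))] 0 := by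
  have hfe : ∀ κ : ℝ, 0 < κ → IntegrableOn (fun y => Real.exp (-(κ * y)) * f y) (Ioi 0) :=
    fun κ hκ => hf.integrable_exp_mul hκ
  have hpow : ∀ k : ℕ, ∀ κ : ℝ, 0 < κ →
      IntegrableOn (fun y => Real.exp (-(κ * y)) * (y ^ k * f y)) (Ioi 0) :=
    fun k κ hκ => integrable_exp_mul_pow_mul hfe k hκ
  have hd := fun (k : ℕ) (i : ℕ) (x : ℝ) =>
    hasDerivAt_hankel_airyKernel c i one_pos (hpow k 1 one_pos) x
  -- The null space is stable under multiplication by `y`, because a transform that vanishes on `[0,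
  -- ∞)` has vanishing second derivative there.
  have hker : ∀ k : ℕ, ∀ x, 0 ≤ x → hankel (airyKernel c 0) (fun y => y ^ k * f y) x = 0 := by
    intro k
    induction k with
    | zero => simpa [airyOp_eq_hankel] using h0
    | succ k ih =>
      have h1 := eq_zero_of_hasDerivAt_of_eqOn_Ici (hd k 0) ih
      have h2 := eq_zero_of_hasDerivAt_of_eqOn_Ici (hd k 1) h1
      intro x hx
      have h3 := hankel_airyKernel_two c (hpow k) x
      rw [h2 x hx, ih x hx, mul_zero, zero_add] at h3
      simpa only [pow_succ', mul_assoc] using h3.symm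
  have hker1 : ∀ k : ℕ, ∀ x, 0 ≤ x → hankel (airyKernel c 1) (fun y => y ^ k * f y) x = 0 :=
    fun k => eq_zero_of_hasDerivAt_of_eqOn_Ici (hd k 0) (hker k)
  -- At `x = 0` the vanishing transforms are exactly the moments of `airyKernel c i · f`.
  have hvan : ∀ i : ℕ, (∀ k : ℕ, ∀ x, 0 ≤ x →
      hankel (airyKernel c i) (fun y => y ^ k * f y) x = 0) →
      (fun y => airyKernel c i y * f y) =ᵐ[volume.restrict (Ioi (0 : ℝ))] 0 := by
    intro i hi
    refine ae_eq_zero_of_moments (fun κ hκ => ?_) fun k => ?_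
    -- The kernel decays at rate `κ + 1`, which leaves rate `1` after the factor `exp (κ y)`.
    · have hK : IsExpKernel 1 fun y => Real.exp (κ * y) * airyKernel c i y := by
        obtain ⟨C, hC, h⟩ := (isExpKernel_airyKernel c i (κ := κ + 1) (by positivity)).bound
        refine ⟨Continuous.mul (by fun_prop) (isExpKernel_airyKernel c i one_pos).continuous,
          C, hC, fun z => ?_⟩
        rw [abs_mul, Real.abs_exp]
        calc _ ≤ Real.exp (κ * z) * (C * Real.exp (-((κ + 1) * z))) := by gcongr; exact h z
          _ = C * Real.exp (-(1 * z)) := by rw [mul_left_comm, ← Real.exp_add]; ring_nf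
      have := hK.integrable_mul_of_exp (hfe 1 one_pos)
      simpa only [IntegrableOn, mul_assoc] using this
    · refine Eq.trans ?_ (hi k 0 le_rfl)
      refine integral_congr_ae (Eventually.of_forall fun y => ?_)
      simp only [zero_add]; ring
  filter_upwards [hvan 0 hker, hvan 1 hker1] with y h1 h2
  rcases airyDeriv_zero_ne_zero_or (y + c) with h | h
  · exact (mul_eq_zero.1 h1).resolve_left h
  · exact (mul_eq_zero.1 h2).resolve_left h

/-! ### Integral identities for eigenfunctions -/

section Eigenfunction

/-- For an eigenfunction `f` with eigenvalue `μ`, the `k`-th derivative of its smooth extension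
to the real line. -/
noncomputable def eigenDeriv (c μ : ℝ) (f : ℝ → ℝ) (k : ℕ) (x : ℝ) : ℝ :=
  μ⁻¹ * hankel (airyKernel c k) f x

variable {c μ ν : ℝ} {f g : ℝ → ℝ}

lemma hasDerivAt_eigenDeriv (hf : MemLp f 2 (volume.restrict (Ioi (0 : ℝ)))) (k : ℕ) (x : ℝ) :
    HasDerivAt (eigenDeriv c μ f k) (eigenDeriv c μ f (k + 1) x) x :=
  (hasDerivAt_hankel_airyKernel c k one_pos (hf.integrable_exp_mul one_pos) x).const_mul _

lemma isExpKernel_eigenDeriv (hf : MemLp f 2 (volume.restrict (Ioi (0 : ℝ)))) (k : ℕ) :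
    IsExpKernel 1 (eigenDeriv c μ f k) := by
  refine IsExpKernel.const_mul ⟨?_, ?_⟩ _
  · exact continuous_iff_continuousAt.2 fun x => (hasDerivAt_hankel_airyKernel c k one_pos
      (hf.integrable_exp_mul one_pos) x).continuousAt
  · exact (isExpKernel_airyKernel c k one_pos).hankel_bound (hf.integrable_exp_mul one_pos)

lemma MemAiryEigenspace.eq_eigenDeriv (hf : MemAiryEigenspace c μ f) (hμ : μ ≠ 0) {x : ℝ}
    (hx : 0 ≤ x) : f x = eigenDeriv c μ f 0 x := by
  rw [eigenDeriv, ← airyOp_eq_hankel, ← hf.2 x hx, inv_mul_cancel_left₀ hμ]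

lemma MemAiryEigenspace.hasDerivWithinAt (hf : MemAiryEigenspace c μ f) (hμ : μ ≠ 0) {x : ℝ}
    (hx : 0 ≤ x) : HasDerivWithinAt f (eigenDeriv c μ f 1 x) (Ici 0) x :=
  (hasDerivAt_eigenDeriv hf.1 0 x).hasDerivWithinAt.congr (fun _ hy => hf.eq_eigenDeriv hμ hy)
    (hf.eq_eigenDeriv hμ hx)

lemma MemAiryEigenspace.derivWithin_eq (hf : MemAiryEigenspace c μ f) (hμ : μ ≠ 0) {x : ℝ}
    (hx : 0 ≤ x) : derivWithin f (Ici 0) x = eigenDeriv c μ f 1 x :=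
  (hf.hasDerivWithinAt hμ hx).derivWithin (uniqueDiffOn_Ici 0 x hx)

lemma MemAiryEigenspace.iteratedDerivWithin_two_eq (hf : MemAiryEigenspace c μ f) (hμ : μ ≠ 0)
    {x : ℝ} (hx : 0 ≤ x) : iteratedDerivWithin 2 f (Ici 0) x = eigenDeriv c μ f 2 x := by
  rw [iteratedDerivWithin_succ]
  refine HasDerivWithinAt.derivWithin ?_ (uniqueDiffOn_Ici 0 x hx)
  refine (hasDerivAt_eigenDeriv hf.1 1 x).hasDerivWithinAt.congr (fun y hy => ?_) ?_
  · rw [iteratedDerivWithin_one, hf.derivWithin_eq hμ hy]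
  · rw [iteratedDerivWithin_one, hf.derivWithin_eq hμ hx]

lemma MemAiryEigenspace.contDiffOn (hf : MemAiryEigenspace c μ f) (hμ : μ ≠ 0) :
    ContDiffOn ℝ 2 f (Ici 0) := by
  have hcont : ∀ n : ℕ, ∀ k, ContDiff ℝ n (eigenDeriv c μ f k) := by
    intro n
    induction n with
    | zero => exact fun k => contDiff_zero.2 (isExpKernel_eigenDeriv hf.1 k).continuous
    | succ n ih =>
      intro k
      have hd := hasDerivAt_eigenDeriv (c := c) (μ := μ) hf.1 k
      rw [Nat.cast_succ, contDiff_succ_iff_deriv]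
      refine ⟨fun x => (hd x).differentiableAt, by simp, ?_⟩
      rw [funext fun x => (hd x).deriv]
      exact ih (k + 1)
  exact (hcont 2 0).contDiffOn.congr fun x hx => hf.eq_eigenDeriv hμ hx

/-- `μ f^(k)` is the Hankel transform of `f` with kernel `airyKernel c k`, and likewise for `ν
g^(k)`; Fubini moves this symmetric kernel from one factor to the other. -/
lemma MemAiryEigenspace.smul_integral_eigenDeriv (hf : MemAiryEigenspace c μ f) (hμ : μ ≠ 0)
    (hg : MemAiryEigenspace c ν g) (hν : ν ≠ 0) (k : ℕ) :
    μ * ∫ x in Ioi (0 : ℝ), eigenDeriv c μ f k x * eigenDeriv c ν g 0 x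
      = ν * ∫ x in Ioi (0 : ℝ), eigenDeriv c μ f 0 x * eigenDeriv c ν g k x := by
  have h := (isExpKernel_airyKernel c k one_pos).integral_hankel_mul
    (hf.1.integrable_exp_mul one_pos) (hg.1.integrable_exp_mul one_pos)
  rw [← integral_const_mul, ← integral_const_mul]
  calc _ = ∫ x in Ioi (0 : ℝ), hankel (airyKernel c k) f x * g x := by
        refine setIntegral_congr_fun measurableSet_Ioi fun x hx => ?_
        simp only [hg.eq_eigenDeriv hν (le_of_lt hx)]
        simp only [eigenDeriv]
        field_simp
    _ = ∫ x in Ioi (0 : ℝ), f x * hankel (airyKernel c k) g x := h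
    _ = _ := by
        refine setIntegral_congr_fun measurableSet_Ioi fun x hx => ?_
        simp only [hf.eq_eigenDeriv hμ (le_of_lt hx)]
        simp only [eigenDeriv]
        field_simp

/-- Symmetry exchanges the derivative between `f` and `g` at the cost of the ratio of eigenvalues;
integration by parts exchanges it at the cost of a sign and a boundary term. -/
lemma MemAiryEigenspace.add_mul_integral_deriv (hf : MemAiryEigenspace c μ f) (hμ : μ ≠ 0)
    (hg : MemAiryEigenspace c ν g) (hν : ν ≠ 0) :
    (μ + ν) * ∫ x in Ioi (0 : ℝ), eigenDeriv c μ f 1 x * eigenDeriv c ν g 0 x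
      = -ν * (f 0 * g 0) := by
  have h1 := hf.smul_integral_eigenDeriv hμ hg hν 1
  have h2 := integral_deriv_mul_add_mul_deriv (isExpKernel_eigenDeriv (c := c) (μ := μ) hf.1 0)
    (isExpKernel_eigenDeriv hf.1 1) (isExpKernel_eigenDeriv (c := c) (μ := ν) hg.1 0)
    (isExpKernel_eigenDeriv hg.1 1) (hasDerivAt_eigenDeriv hf.1 0) (hasDerivAt_eigenDeriv hg.1 0)
  rw [hf.eq_eigenDeriv hμ le_rfl, hg.eq_eigenDeriv hν le_rfl]
  linear_combination h1 + ν * h2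

/-- The same argument with two integrations by parts, whose signs cancel; hence `μ - ν` in place of
`μ + ν`. -/
lemma MemAiryEigenspace.sub_mul_integral_deriv_two (hf : MemAiryEigenspace c μ f) (hμ : μ ≠ 0)
    (hg : MemAiryEigenspace c ν g) (hν : ν ≠ 0) :
    (μ - ν) * ∫ x in Ioi (0 : ℝ), eigenDeriv c μ f 2 x * eigenDeriv c ν g 0 x
      = ν * (eigenDeriv c μ f 1 0 * g 0 - f 0 * eigenDeriv c ν g 1 0) := by
  have h1 := hf.smul_integral_eigenDeriv hμ hg hν 2
  have h2 := integral_deriv_mul_add_mul_deriv (isExpKernel_eigenDeriv (c := c) (μ := μ) hf.1 1)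
    (isExpKernel_eigenDeriv hf.1 2) (isExpKernel_eigenDeriv (c := c) (μ := ν) hg.1 0)
    (isExpKernel_eigenDeriv hg.1 1) (hasDerivAt_eigenDeriv hf.1 1) (hasDerivAt_eigenDeriv hg.1 0)
  have h3 := integral_deriv_mul_add_mul_deriv (isExpKernel_eigenDeriv (c := c) (μ := μ) hf.1 0)
    (isExpKernel_eigenDeriv hf.1 1) (isExpKernel_eigenDeriv (c := c) (μ := ν) hg.1 1)
    (isExpKernel_eigenDeriv hg.1 2) (hasDerivAt_eigenDeriv hf.1 0) (hasDerivAt_eigenDeriv hg.1 1)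
  rw [hf.eq_eigenDeriv hμ le_rfl, hg.eq_eigenDeriv hν le_rfl]
  linear_combination h1 - ν * h2 + ν * h3

lemma MemAiryEigenspace.integral_mul_eq_zero (hf : MemAiryEigenspace c μ f) (hμ : μ ≠ 0)
    (hg : MemAiryEigenspace c ν g) (hν : ν ≠ 0) (hne : μ ≠ ν) :
    ∫ x in Ioi (0 : ℝ), eigenDeriv c μ f 0 x * eigenDeriv c ν g 0 x = 0 := by
  have h := hf.smul_integral_eigenDeriv hμ hg hν 0
  rw [← sub_eq_zero, ← sub_mul, mul_eq_zero] at h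
  exact h.resolve_left (sub_ne_zero.2 hne)

lemma IsExpKernel.integrable_id_mul {a b : ℝ → ℝ} (ha : IsExpKernel 1 a) (hb : IsExpKernel 1 b) :
    IntegrableOn (fun x => x * a x * b x) (Ioi 0) := by
  have h := integrable_exp_mul_pow_mul (f := a)
    (fun κ hκ => (ha.memLp one_pos).integrable_exp_mul hκ) 1 one_pos
  have := hb.integrable_mul_of_exp h
  simpa [IntegrableOn, mul_comm (b _)] using this

/-- Pair `μ f'' = (x + c) μ f + T_c[x f]` with `g`. Symmetry turns the last term into `ν ∫ x f g`,
and orthogonality removes the term with `c`. -/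
lemma MemAiryEigenspace.add_mul_integral_id (hf : MemAiryEigenspace c μ f) (hμ : μ ≠ 0)
    (hg : MemAiryEigenspace c ν g) (hν : ν ≠ 0) (hne : μ ≠ ν) :
    (μ + ν) * ∫ x in Ioi (0 : ℝ), x * eigenDeriv c μ f 0 x * eigenDeriv c ν g 0 x
      = μ * ∫ x in Ioi (0 : ℝ), eigenDeriv c μ f 2 x * eigenDeriv c ν g 0 x := by
  have hfe : ∀ κ : ℝ, 0 < κ → IntegrableOn (fun y => Real.exp (-(κ * y)) * f y) (Ioi 0) :=
    fun κ hκ => hf.1.integrable_exp_mul hκ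
  have hyf : IntegrableOn (fun y => Real.exp (-(1 * y)) * (y * f y)) (Ioi 0) := by
    simpa using integrable_exp_mul_pow_mul hfe 1 one_pos
  have hF := isExpKernel_eigenDeriv (c := c) (μ := μ) hf.1 0
  have hG := isExpKernel_eigenDeriv (c := c) (μ := ν) hg.1 0
  have hs := (isExpKernel_airyKernel c 0 one_pos).integral_hankel_mul hyf
    (hg.1.integrable_exp_mul one_pos)
  have e1 : ∫ x in Ioi (0 : ℝ), hankel (airyKernel c 0) (fun y => y * f y) x * g x
      = ∫ x in Ioi (0 : ℝ), μ * (eigenDeriv c μ f 2 x * eigenDeriv c ν g 0 x)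
        - (μ * (x * eigenDeriv c μ f 0 x * eigenDeriv c ν g 0 x)
          + c * μ * (eigenDeriv c μ f 0 x * eigenDeriv c ν g 0 x)) := by
    refine setIntegral_congr_fun measurableSet_Ioi fun x hx => ?_
    have h2 := hankel_airyKernel_two c hfe x
    simp only [hg.eq_eigenDeriv hν (le_of_lt hx)]
    have e0 : hankel (airyKernel c 0) f x = μ * eigenDeriv c μ f 0 x := by
      rw [eigenDeriv, mul_inv_cancel_left₀ hμ]
    have e2 : hankel (airyKernel c 2) f x = μ * eigenDeriv c μ f 2 x := by
      rw [eigenDeriv, mul_inv_cancel_left₀ hμ]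
    rw [e0, e2] at h2
    linear_combination (-eigenDeriv c ν g 0 x) * h2
  have e3 : ∫ x in Ioi (0 : ℝ), x * f x * hankel (airyKernel c 0) g x
      = ∫ x in Ioi (0 : ℝ), ν * (x * eigenDeriv c μ f 0 x * eigenDeriv c ν g 0 x) := by
    refine setIntegral_congr_fun measurableSet_Ioi fun x hx => ?_
    simp only [hf.eq_eigenDeriv hμ (le_of_lt hx)]
    simp only [eigenDeriv]
    field_simp
  have i1 := ((isExpKernel_eigenDeriv (c := c) (μ := μ) hf.1 2).integrable_mul hG).const_mul μ
  have i2 := (hF.integrable_id_mul hG).const_mul μ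
  have i3 := (hF.integrable_mul hG).const_mul (c * μ)
  rw [e1, e3] at hs
  erw [integral_sub i1 (i2.add i3), integral_add i2 i3] at hs
  simp only [integral_const_mul] at hs
  rw [hf.integral_mul_eq_zero hμ hg hν hne] at hs
  linear_combination -hs

/-- The derivative of an eigenfunction vanishing at `0` is an eigenfunction for the negative
eigenvalue. -/
lemma MemAiryEigenspace.neg_of_zero (hf : MemAiryEigenspace c μ f) (hμ : μ ≠ 0) (h0 : f 0 = 0) :
    MemAiryEigenspace c (-μ) (eigenDeriv c μ f 1) := by
  refine ⟨(isExpKernel_eigenDeriv hf.1 1).memLp one_pos, fun x _ => ?_⟩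
  have hK : ∀ k, IsExpKernel 1 fun y => airyKernel c k (x + y) := fun k => by
    simpa only [add_comm x] using (isExpKernel_airyKernel c k one_pos).comp_add x
  have hd : ∀ y, HasDerivAt (fun y => airyKernel c 0 (x + y)) (airyKernel c 1 (x + y)) y :=
    fun y => (hasDerivAt_airyKernel c 0 (x + y)).comp_const_add x y
  -- Integrating by parts in `y` changes `∫ Ai'(x + y + c) f(y)` into `-T_c[f'](x)`; the boundary
  -- term carries `f 0 = 0`.
  have h := integral_deriv_mul_add_mul_deriv (hK 0) (hK 1)
    (isExpKernel_eigenDeriv (c := c) (μ := μ) hf.1 0) (isExpKernel_eigenDeriv hf.1 1) hd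
    (hasDerivAt_eigenDeriv hf.1 0)
  rw [← hf.eq_eigenDeriv hμ le_rfl, h0, mul_zero, neg_zero] at h
  have e : ∫ y in Ioi (0 : ℝ), airyKernel c 1 (x + y) * eigenDeriv c μ f 0 y
      = μ * eigenDeriv c μ f 1 x := by
    rw [eigenDeriv, mul_inv_cancel_left₀ hμ, hankel]
    refine setIntegral_congr_fun measurableSet_Ioi fun y hy => ?_
    simp only [hf.eq_eigenDeriv hμ (le_of_lt hy)]
  rw [airyOp_eq_hankel, hankel]
  linarith

lemma MemAiryEigenspace.add (hf : MemAiryEigenspace c μ f) (hg : MemAiryEigenspace c μ g) :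
    MemAiryEigenspace c μ fun x => f x + g x := by
  refine ⟨hf.1.add hg.1, fun x hx => ?_⟩
  have hK := isExpKernel_airyKernel c 0 one_pos
  rw [mul_add, hf.2 x hx, hg.2 x hx, airyOp_eq_hankel, airyOp_eq_hankel, airyOp_eq_hankel]
  simp only [hankel, mul_add]
  exact (integral_add (hK.integrable_hankel (hf.1.integrable_exp_mul one_pos) x)
    (hK.integrable_hankel (hg.1.integrable_exp_mul one_pos) x)).symm

lemma MemAiryEigenspace.const_mul (hf : MemAiryEigenspace c μ f) (r : ℝ) :
    MemAiryEigenspace c μ fun x => r * f x := by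
  refine ⟨hf.1.const_mul r, fun x hx => ?_⟩
  rw [mul_left_comm, hf.2 x hx, airyOp, airyOp, ← integral_const_mul]
  simp only [mul_left_comm]

end Eigenfunction

/-! ### Simplicity of the spectrum and the formulas at fixed `c` -/

namespace IsAiryEigensystem

variable {c : ℝ} {lam : ℕ → ℝ} {psi : ℕ → ℝ → ℝ}

lemma not_ae_eq_zero (h : IsAiryEigensystem c lam psi) (j : ℕ) :
    ¬ psi j =ᵐ[volume.restrict (Ioi (0 : ℝ))] 0 := fun h0 => by
  have h1 := h.norm_one j
  rw [integral_eq_zero_of_ae (h0.mono fun x hx => by simp [hx])] at h1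
  exact zero_ne_one h1

lemma lam_ne_zero (h : IsAiryEigensystem c lam psi) (j : ℕ) : lam j ≠ 0 := fun h0 =>
  h.not_ae_eq_zero j (ae_eq_zero_of_airyOp_eq_zero (h.eigen j).1 fun x hx => by
    rw [← (h.eigen j).2 x hx, h0, zero_mul])

/-- Otherwise the identity for `∫ ψ_m' ψ_n` would make its boundary term vanish, against the
positivity of the `ψ_j(0)`. -/
lemma add_ne_zero (h : IsAiryEigensystem c lam psi) (m n : ℕ) : lam m + lam n ≠ 0 := fun h0 => by
  have h1 := (h.eigen m).add_mul_integral_deriv (h.lam_ne_zero m) (h.eigen n) (h.lam_ne_zero n)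
  rw [h0, zero_mul, eq_comm] at h1
  exact mul_ne_zero (neg_ne_zero.2 (h.lam_ne_zero n))
    (mul_pos (h.pos_zero m) (h.pos_zero n)).ne' h1

/-- Every eigenfunction belongs to a listed eigenvalue. -/
lemma ae_eq_zero_of_forall_ne (h : IsAiryEigensystem c lam psi) {μ : ℝ} {f : ℝ → ℝ}
    (hf : MemAiryEigenspace c μ f) (hμ : ∀ j, lam j ≠ μ) :
    f =ᵐ[volume.restrict (Ioi (0 : ℝ))] 0 := by
  obtain ⟨a, ha, -⟩ := h.basis μ f hf
  have : IsEmpty {j : ℕ // lam j = μ} := ⟨fun j => hμ j j.2⟩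
  filter_upwards [ha] with x hx
  rw [hx, Subsingleton.elim a 0, Finsupp.sum_zero_index, Pi.zero_apply]

/-- An eigenfunction vanishing at `0` is zero. -/
lemma eq_zero_of_apply_zero (h : IsAiryEigensystem c lam psi) (j : ℕ) {f : ℝ → ℝ}
    (hf : MemAiryEigenspace c (lam j) f) (h0 : f 0 = 0) {x : ℝ} (hx : 0 ≤ x) : f x = 0 := by
  have hμ := h.lam_ne_zero j
  have hneg := hf.neg_of_zero hμ h0
  -- The derivative belongs to `-lam j`, which is no listed eigenvalue since sums of eigenvalues are
  -- nonzero.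
  have hae := h.ae_eq_zero_of_forall_ne hneg fun k hk => h.add_ne_zero k j (by rw [hk]; ring)
  have hF1 : ∀ y, 0 ≤ y → eigenDeriv c (lam j) f 1 y = 0 := fun y hy => by
    have h1 := hneg.2 y hy
    rw [airyOp, integral_eq_zero_of_ae (hae.mono fun z hz => by simp [hz])] at h1
    exact (mul_eq_zero.1 h1).resolve_left (neg_ne_zero.2 hμ)
  have hd := hasDerivAt_eigenDeriv (c := c) (μ := lam j) hf.1 0
  have hconst := constant_of_has_deriv_right_zero (a := 0) (b := x)
    (isExpKernel_eigenDeriv (c := c) (μ := lam j) hf.1 0).continuous.continuousOn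
    (fun y hy => by
      have := (hd y).hasDerivWithinAt (s := Ici y)
      rwa [zero_add, hF1 y hy.1] at this) x (right_mem_Icc.2 hx)
  rw [hf.eq_eigenDeriv hμ hx, hconst, ← hf.eq_eigenDeriv hμ le_rfl, h0]

/-- The eigenvalues are simple. -/
lemma lam_injective (h : IsAiryEigensystem c lam psi) : Function.Injective lam := by
  intro m n hmn
  by_contra hne
  have hm := (h.eigen m).const_mul (psi n 0)
  have hn := (h.eigen n).const_mul (-psi m 0)
  rw [← hmn] at hn
  -- This combination is built to vanish at `0`. It makes `psi m` a multiple of `psi n`, which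
  -- contradicts uniqueness of coordinates in the eigenspace basis.
  have hzero : ∀ x, 0 ≤ x → psi n 0 * psi m x + -psi m 0 * psi n x = 0 := fun x hx =>
    h.eq_zero_of_apply_zero m (hm.add hn) (by ring) hx
  obtain ⟨a, -, hu⟩ := h.basis (lam m) (psi m) (h.eigen m)
  have h1 := hu (Finsupp.single ⟨m, rfl⟩ 1) (Eventually.of_forall fun x => by
    simp)
  have h2 := hu (Finsupp.single ⟨n, hmn.symm⟩ (psi m 0 / psi n 0)) (by
    filter_upwards [ae_restrict_mem measurableSet_Ioi] with x hx
    have := hzero x (le_of_lt hx)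
    have hn0 := (h.pos_zero n).ne'
    rw [Finsupp.sum_single_index (by simp)]
    field_simp
    linarith)
  have h3 := (Finsupp.single_eq_single_iff _ _ _ _).1 (h1.trans h2.symm)
  rcases h3 with ⟨h3, -⟩ | ⟨h3, -⟩
  · exact hne (Subtype.ext_iff.1 h3)
  · exact one_ne_zero h3

lemma strictAnti_abs (h : IsAiryEigensystem c lam psi) : StrictAnti fun j => |lam j| := by
  refine h.antitone_abs.strictAnti_of_injective fun m n hmn => ?_
  rcases abs_eq_abs.1 hmn with e | e
  · exact h.lam_injective e
  · exact absurd (by rw [e]; ring) (h.add_ne_zero m n)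

lemma sq_sub_sq_ne_zero (h : IsAiryEigensystem c lam psi) {m n : ℕ} (hmn : m ≠ n) :
    lam n ^ 2 - lam m ^ 2 ≠ 0 := by
  rw [sq_sub_sq]
  exact mul_ne_zero (h.add_ne_zero n m) (sub_ne_zero.2 fun e => hmn (h.lam_injective e).symm)

lemma integral_mul_eq_ite (h : IsAiryEigensystem c lam psi) (m n : ℕ) :
    ∫ x in Ioi (0 : ℝ), psi m x * psi n x = if m = n then 1 else 0 := by
  split_ifs with hmn
  · subst hmn
    simpa only [sq] using h.norm_one m
  · refine Eq.trans ?_ ((h.eigen m).integral_mul_eq_zero (h.lam_ne_zero m) (h.eigen n)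
      (h.lam_ne_zero n) fun e => hmn (h.lam_injective e))
    refine setIntegral_congr_fun measurableSet_Ioi fun x hx => ?_
    simp only [(h.eigen m).eq_eigenDeriv (h.lam_ne_zero m) (le_of_lt hx),
      (h.eigen n).eq_eigenDeriv (h.lam_ne_zero n) (le_of_lt hx)]

lemma integral_deriv_mul (h : IsAiryEigensystem c lam psi) (m n : ℕ) :
    IntegrableOn (fun x => derivWithin (psi n) (Ici 0) x * psi m x) (Ioi 0) ∧
      ∫ x in Ioi (0 : ℝ), derivWithin (psi n) (Ici 0) x * psi m x
        = -(lam m / (lam n + lam m)) * (psi n 0 * psi m 0) := by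
  have hn := h.lam_ne_zero n
  have hm := h.lam_ne_zero m
  have hs := h.add_ne_zero n m
  have e : EqOn (fun x => derivWithin (psi n) (Ici 0) x * psi m x)
      (fun x => eigenDeriv c (lam n) (psi n) 1 x * eigenDeriv c (lam m) (psi m) 0 x) (Ioi 0) :=
    fun x hx => by
      simp only [(h.eigen n).derivWithin_eq hn (le_of_lt hx),
        (h.eigen m).eq_eigenDeriv hm (le_of_lt hx)]
  refine ⟨((isExpKernel_eigenDeriv (h.eigen n).1 1).integrable_mul
    (isExpKernel_eigenDeriv (h.eigen m).1 0)).congr_fun e.symm measurableSet_Ioi, ?_⟩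
  rw [setIntegral_congr_fun measurableSet_Ioi e]
  have := (h.eigen n).add_mul_integral_deriv hn (h.eigen m) hm
  field_simp
  linarith

lemma integral_deriv_two_mul (h : IsAiryEigensystem c lam psi) {m n : ℕ} (hmn : m ≠ n) :
    IntegrableOn (fun x => iteratedDerivWithin 2 (psi n) (Ici 0) x * psi m x) (Ioi 0) ∧
      ∫ x in Ioi (0 : ℝ), iteratedDerivWithin 2 (psi n) (Ici 0) x * psi m x
        = lam m / (lam n - lam m) * (derivWithin (psi n) (Ici 0) 0 * psi m 0
          - psi n 0 * derivWithin (psi m) (Ici 0) 0) := by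
  have hn := h.lam_ne_zero n
  have hm := h.lam_ne_zero m
  have hs : lam n - lam m ≠ 0 := sub_ne_zero.2 fun e => hmn (h.lam_injective e).symm
  have e : EqOn (fun x => iteratedDerivWithin 2 (psi n) (Ici 0) x * psi m x)
      (fun x => eigenDeriv c (lam n) (psi n) 2 x * eigenDeriv c (lam m) (psi m) 0 x) (Ioi 0) :=
    fun x hx => by
      simp only [(h.eigen n).iteratedDerivWithin_two_eq hn (le_of_lt hx),
        (h.eigen m).eq_eigenDeriv hm (le_of_lt hx)]
  refine ⟨((isExpKernel_eigenDeriv (h.eigen n).1 2).integrable_mul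
    (isExpKernel_eigenDeriv (h.eigen m).1 0)).congr_fun e.symm measurableSet_Ioi, ?_⟩
  rw [setIntegral_congr_fun measurableSet_Ioi e, (h.eigen n).derivWithin_eq hn le_rfl,
    (h.eigen m).derivWithin_eq hm le_rfl]
  have := (h.eigen n).sub_mul_integral_deriv_two hn (h.eigen m) hm
  field_simp
  linarith

lemma integral_id_mul_mul (h : IsAiryEigensystem c lam psi) {m n : ℕ} (hmn : m ≠ n) :
    IntegrableOn (fun x => x * psi n x * psi m x) (Ioi 0) ∧
      ∫ x in Ioi (0 : ℝ), x * psi n x * psi m x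
        = lam n * lam m / (lam n ^ 2 - lam m ^ 2) * (derivWithin (psi n) (Ici 0) 0 * psi m 0
          - psi n 0 * derivWithin (psi m) (Ici 0) 0) := by
  have hn := h.lam_ne_zero n
  have hm := h.lam_ne_zero m
  have hne : lam n ≠ lam m := fun e => hmn (h.lam_injective e).symm
  have e : EqOn (fun x => x * psi n x * psi m x)
      (fun x => x * eigenDeriv c (lam n) (psi n) 0 x * eigenDeriv c (lam m) (psi m) 0 x)
      (Ioi 0) := fun x hx => by
    simp only [(h.eigen n).eq_eigenDeriv hn (le_of_lt hx),
      (h.eigen m).eq_eigenDeriv hm (le_of_lt hx)]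
  refine ⟨((isExpKernel_eigenDeriv (h.eigen n).1 0).integrable_id_mul
    (isExpKernel_eigenDeriv (h.eigen m).1 0)).congr_fun e.symm measurableSet_Ioi, ?_⟩
  rw [setIntegral_congr_fun measurableSet_Ioi e, (h.eigen n).derivWithin_eq hn le_rfl,
    (h.eigen m).derivWithin_eq hm le_rfl, div_mul_eq_mul_div, eq_div_iff (h.sq_sub_sq_ne_zero hmn)]
  have h1 := (h.eigen n).sub_mul_integral_deriv_two hn (h.eigen m) hm
  have h2 := (h.eigen n).add_mul_integral_id hn (h.eigen m) hm hne
  linear_combination (lam n - lam m) * h2 + lam n * h1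

end IsAiryEigensystem

/-! ### Perturbation of simple eigenvalues in a Hilbert space -/

section EigenPerturbation

open scoped Topology RealInnerProductSpace

variable {H : Type*} [NormedAddCommGroup H] [InnerProductSpace ℝ H]

lemma HilbertBasis.norm_le_of_abs_inner_le {ι : Type*} (b : HilbertBasis ι ℝ H) {f g : H}
    (h : ∀ j, |⟪b j, f⟫| ≤ |⟪b j, g⟫|) : ‖f‖ ≤ ‖g‖ := by
  have hs : ∀ x : H, HasSum (fun j => ⟪b j, x⟫ ^ 2) (‖x‖ ^ 2) := fun x => by
    have := b.hasSum_inner_mul_inner x x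
    rw [real_inner_self_eq_norm_sq] at this
    simpa only [sq, real_inner_comm] using this
  exact (sq_le_sq₀ (norm_nonneg _) (norm_nonneg _)).1
    (hasSum_le (fun j => sq_le_sq.2 (h j)) (hs f) (hs g))

/-- `T` is symmetric and `b` is a Hilbert basis of eigenvectors with eigenvalues `l`. -/
structure IsDiagonalIn (T : H →L[ℝ] H) (b : HilbertBasis ℕ ℝ H) (l : ℕ → ℝ) : Prop where
  symm : ∀ x y, ⟪T x, y⟫ = ⟪x, T y⟫
  eigen : ∀ j, T (b j) = l j • b j

namespace IsDiagonalIn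

variable {T T' : H →L[ℝ] H} {b b' : HilbertBasis ℕ ℝ H} {l l' : ℕ → ℝ}

lemma inner_apply (h : IsDiagonalIn T b l) (j : ℕ) (f : H) : ⟪b j, T f⟫ = l j * ⟪b j, f⟫ := by
  rw [← h.symm, h.eigen, real_inner_smul_left]

lemma inner_apply_sub_smul (h : IsDiagonalIn T b l) (j : ℕ) (μ : ℝ) (f : H) :
    ⟪b j, T f - μ • f⟫ = (l j - μ) * ⟪b j, f⟫ := by
  rw [inner_sub_right, h.inner_apply, real_inner_smul_right]; ring

/-- Weyl's inequality by the min-max argument: by dimension count some nonzero `f` in the span of `b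
0, …, b n` is orthogonal to `b' 0, …, b' (n - 1)`, so that `‖T f‖ ≥ |l n| ‖f‖` and `‖T' f‖ ≤ |l' n|
‖f‖`. -/
lemma abs_le_abs_add_norm_sub (h : IsDiagonalIn T b l) (h' : IsDiagonalIn T' b' l')
    (hl : Antitone fun j => |l j|) (hl' : Antitone fun j => |l' j|) (n : ℕ) :
    |l n| ≤ |l' n| + ‖T - T'‖ := by
  let A : (Fin (n + 1) → ℝ) →ₗ[ℝ] (Fin n → ℝ) :=
    LinearMap.pi fun i => (innerₗ H (b' i)) ∘ₗ Fintype.linearCombination ℝ fun j : Fin (n + 1) => b j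
  have hker : LinearMap.ker A ≠ ⊥ := LinearMap.ker_ne_bot_of_finrank_lt (by simp)
  obtain ⟨a, ha, ha0⟩ := Submodule.exists_mem_ne_zero_of_ne_bot hker
  set f : H := ∑ j : Fin (n + 1), a j • b j with hf
  have hA : ∀ i : Fin n, ⟪b' i, f⟫ = 0 := fun i =>
    congrFun (LinearMap.mem_ker.1 ha) i
  have hcoef : ∀ k, ⟪b k, f⟫ = ∑ j : Fin (n + 1), a j * if k = j then 1 else 0 := fun k => by
    rw [hf, inner_sum]
    refine Finset.sum_congr rfl fun j _ => ?_
    rw [real_inner_smul_right, orthonormal_iff_ite.1 b.orthonormal]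
  have hf0 : f ≠ 0 := fun h0 => by
    refine ha0 (funext fun i => ?_)
    have h1 := hcoef i
    rw [h0, inner_zero_right] at h1
    simpa only [Pi.zero_apply, Fin.val_inj, mul_ite, mul_one, mul_zero, Finset.sum_ite_eq, Finset.mem_univ,
      if_true] using h1.symm
  have hlow : |l n| * ‖f‖ ≤ ‖T f‖ := by
    have := b.norm_le_of_abs_inner_le (f := l n • f) (g := T f) fun j => by
      rw [h.inner_apply, real_inner_smul_right, abs_mul, abs_mul]
      rcases le_or_gt j n with hj | hj
      · exact mul_le_mul_of_nonneg_right (hl hj) (abs_nonneg _)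
      · have : ⟪b j, f⟫ = 0 := by
          rw [hcoef]
          refine Finset.sum_eq_zero fun i _ => ?_
          rw [if_neg (by have := i.2; omega), mul_zero]
        simp [this]
    rwa [norm_smul, Real.norm_eq_abs] at this
  have hup : ‖T' f‖ ≤ |l' n| * ‖f‖ := by
    have := b'.norm_le_of_abs_inner_le (g := l' n • f) (f := T' f) fun j => by
      rw [h'.inner_apply, real_inner_smul_right, abs_mul, abs_mul]
      rcases lt_or_ge j n with hj | hj
      · simp [hA ⟨j, hj⟩]
      · exact mul_le_mul_of_nonneg_right (hl' hj) (abs_nonneg _)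
    rwa [norm_smul, Real.norm_eq_abs] at this
  have hsub : ‖T f‖ ≤ ‖T' f‖ + ‖T - T'‖ * ‖f‖ := by
    have := (T - T').le_opNorm f
    calc ‖T f‖ = ‖T' f + (T - T') f‖ := by simp
      _ ≤ _ := (norm_add_le _ _).trans (by gcongr)
  have hfp : 0 < ‖f‖ := norm_pos_iff.2 hf0
  refine le_of_mul_le_mul_right ?_ hfp
  linarith [add_mul |l' n| ‖T - T'‖ ‖f‖]

/-- Quantitative spectral gap: an approximate eigenvector for `μ` is close to its component along `b
n`, as all other coordinates are multiplied by at least `δ`. -/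
lemma mul_norm_sub_le (h : IsDiagonalIn T b l) {n : ℕ} {μ δ : ℝ} (hδ : 0 ≤ δ)
    (hgap : ∀ j, j ≠ n → δ ≤ |l j - μ|) (f : H) :
    δ * ‖f - ⟪b n, f⟫ • b n‖ ≤ ‖T f - μ • f‖ := by
  have := b.norm_le_of_abs_inner_le (f := δ • (f - ⟪b n, f⟫ • b n)) (g := T f - μ • f) fun j => by
    rw [h.inner_apply_sub_smul, real_inner_smul_right, inner_sub_right, real_inner_smul_right,
      orthonormal_iff_ite.1 b.orthonormal, abs_mul, abs_mul, abs_of_nonneg hδ]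
    split_ifs with hj
    · subst hj; simp only [mul_one, sub_self, abs_zero, mul_zero]; positivity
    · rw [mul_zero, sub_zero]
      exact mul_le_mul_of_nonneg_right (hgap j hj) (abs_nonneg _)
  rwa [norm_smul, Real.norm_of_nonneg hδ] at this

end IsDiagonalIn

lemma exists_gap_of_strictAnti {a : ℕ → ℝ} (ha : StrictAnti a) (n : ℕ) :
    ∃ δ > 0, ∀ j, j ≠ n → δ ≤ |a j - a n| := by
  have h1 : ∀ j, n < j → a n - a (n + 1) ≤ |a j - a n| := fun j hj => by
    have := ha.antitone (Nat.succ_le_of_lt hj)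
    rw [abs_sub_comm]
    exact (sub_le_sub_left this _).trans (le_abs_self _)
  rcases Nat.eq_zero_or_pos n with rfl | hn
  · exact ⟨_, sub_pos.2 (ha (Nat.lt_succ_self 0)), fun j hj => h1 j (Nat.pos_of_ne_zero hj)⟩
  · refine ⟨min (a n - a (n + 1)) (a (n - 1) - a n), lt_min (sub_pos.2 (ha (Nat.lt_succ_self n)))
      (sub_pos.2 (ha (by omega))), fun j hj => ?_⟩
    rcases lt_or_gt_of_ne hj with h | h
    · have := ha.antitone (show j ≤ n - 1 by omega)
      exact (min_le_right _ _).trans ((sub_le_sub_right this _).trans (le_abs_self _))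
    · exact (min_le_left _ _).trans (h1 j h)

/-- Differentiability of eigenvalues and normalized eigenvectors of a family of symmetric operators
whose eigenvalues have distinct absolute values; the signs of the eigenvectors are fixed by the
vectors `k t`. -/
theorem exists_hasDerivAt_eigenvector [CompleteSpace H] {T : ℝ → H →L[ℝ] H} {T' : H →L[ℝ] H}
    {b : ℝ → HilbertBasis ℕ ℝ H} {l : ℝ → ℕ → ℝ} {c : ℝ}
    (hdiag : ∀ t, IsDiagonalIn (T t) (b t) (l t)) (hanti : ∀ t, StrictAnti fun j => |l t j|)
    (hT : HasDerivAt T T' c) (n : ℕ) {k : ℝ → H} (hk : ContinuousAt k c)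
    (hsign : ∀ t, 0 < ⟪k t, b t n⟫ / l t n) :
    ∃ (w : H) (l' : ℝ), HasDerivAt (fun t => b t n) w c ∧ HasDerivAt (fun t => l t n) l' c := by
  set e : H := b c n with he
  set s : ℝ → ℝ := fun t => ⟪e, b t n⟫ with hs
  -- Rescaling to `⟪φ t, e⟫ = 1` removes the sign ambiguity; the sign is restored only at the end,
  -- through `k`.
  set φ : ℝ → H := fun t => (s t)⁻¹ • b t n with hφ
  have hnorm : ∀ t, ‖b t n‖ = 1 := fun t => (b t).orthonormal.1 n
  have hee : ⟪e, e⟫ = 1 := by rw [real_inner_self_eq_norm_sq, he, hnorm, one_pow]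
  have hsc : s c = 1 := hee
  have hTe : T c e = l c n • e := (hdiag c).eigen n
  have hφc : φ c = e := by simp only [hφ, hsc, inv_one, one_smul, ← he]
  have hTn : Tendsto (fun t => ‖T t - T c‖) (𝓝 c) (𝓝 0) := by
    have := (hT.continuousAt.sub (continuousAt_const (y := T c))).norm
    simpa [ContinuousAt] using this
  obtain ⟨δ, hδ, hgap⟩ := exists_gap_of_strictAnti (hanti c) n
  have hl : Tendsto (fun t => ‖|l t n| - |l c n|‖) (𝓝 c) (𝓝 0) := by
    refine squeeze_zero_norm (fun t => ?_) hTn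
    rw [norm_norm, Real.norm_eq_abs, abs_sub_le_iff]
    constructor
    · have := (hdiag t).abs_le_abs_add_norm_sub (hdiag c) (hanti t).antitone (hanti c).antitone n
      linarith
    · have := (hdiag c).abs_le_abs_add_norm_sub (hdiag t) (hanti c).antitone (hanti t).antitone n
      rw [norm_sub_rev] at this
      linarith
  -- the component of the eigenvector orthogonal to `e` tends to zero
  have hq : Tendsto (fun t => b t n - s t • e) (𝓝 c) (𝓝 0) := by
    have hlim : Tendsto (fun t => (δ / 2)⁻¹ * ‖T t - T c‖) (𝓝 c) (𝓝 0) := by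
      simpa only [mul_zero] using hTn.const_mul (δ / 2)⁻¹
    refine squeeze_zero_norm' ?_ hlim
    filter_upwards [hl.eventually (ge_mem_nhds (half_pos hδ))] with t ht
    -- Weyl's inequality controls only absolute values, but these are separated by `δ`, so half of
    -- the gap survives around `l t n`. The residual of `b t n` for `T c` is `(T c - T t) (b t n)`.
    have h1 := (hdiag c).mul_norm_sub_le (half_pos hδ).le (n := n) (μ := l t n) (fun j hj => by
      have h2 := hgap j hj
      have h3 := abs_abs_sub_abs_le_abs_sub (l c j) (l t n)
      have h4 := abs_sub_le (|l c j|) (|l t n|) (|l c n|)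
      rw [Real.norm_eq_abs] at ht
      linarith) (b t n)
    rw [inv_mul_eq_div, le_div_iff₀' (half_pos hδ)]
    refine h1.trans ?_
    rw [← (hdiag t).eigen n, norm_sub_rev, ← sub_apply]
    simpa [hnorm] using (T t - T c).le_opNorm (b t n)
  have hs2 : Tendsto (fun t => s t ^ 2) (𝓝 c) (𝓝 1) := by
    have h1 : ∀ t, s t ^ 2 = 1 - ‖b t n - s t • e‖ ^ 2 := fun t => by
      rw [norm_sub_sq_real, norm_smul, real_inner_smul_right, real_inner_comm, hnorm, he, hnorm,
        Real.norm_eq_abs, mul_one, sq_abs]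
      simp only [hs]; ring
    simp_rw [h1]
    simpa using (hq.norm.pow 2).const_sub 1
  have hs0 : ∀ᶠ t in 𝓝 c, s t ≠ 0 := by
    filter_upwards [hs2.eventually (lt_mem_nhds (show (0 : ℝ) < 1 by norm_num))] with t ht h0
    simp [h0] at ht
  have hφe : Tendsto φ (𝓝 c) (𝓝 e) := by
    have h1 : Tendsto (fun t => φ t - e) (𝓝 c) (𝓝 0) := by
      have hinv : Tendsto (fun t => (Real.sqrt (s t ^ 2))⁻¹) (𝓝 c) (𝓝 1) := by
        simpa using ((Real.continuous_sqrt.tendsto _).comp hs2).inv₀ (by simp)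
      refine squeeze_zero_norm' ?_ (by simpa using hinv.mul hq.norm)
      filter_upwards [hs0] with t ht
      have : φ t - e = (s t)⁻¹ • (b t n - s t • e) := by
        rw [smul_sub, inv_smul_smul₀ ht]
      rw [this, norm_smul, norm_inv, Real.norm_eq_abs, Real.sqrt_sq_eq_abs]
    simpa using h1.add_const e
  have hφeig : ∀ t, T t (φ t) = l t n • φ t := fun t => by
    rw [hφ, map_smul, (hdiag t).eigen n, smul_comm]
  have hφinner : ∀ᶠ t in 𝓝 c, ⟪φ t, e⟫ = 1 := by
    filter_upwards [hs0] with t ht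
    rw [hφ, real_inner_smul_left, real_inner_comm]
    exact inv_mul_cancel₀ ht
  have hslT := hasDerivAt_iff_tendsto_slope.1 hT
  have hφe' := hφe.mono_left (nhdsWithin_le_nhds (s := {c}ᶜ))
  have hTφ : Tendsto (fun t => slope T c t (φ t)) (𝓝[≠] c) (𝓝 (T' e)) :=
    (isBoundedBilinearMap_apply.continuous.tendsto (T', e)).comp (hslT.prodMk_nhds hφe')
  -- derivative of the eigenvalue
  have hld : Tendsto (slope (fun t => l t n) c) (𝓝[≠] c) (𝓝 ⟪T' e, e⟫) := by
    refine (hTφ.inner tendsto_const_nhds).congr' ?_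
    filter_upwards [nhdsWithin_le_nhds hφinner] with t ht
    have h1 : ⟪(T t - T c) (φ t), e⟫ = l t n - l c n := by
      rw [sub_apply, inner_sub_left, hφeig, (hdiag c).symm, hTe, real_inner_smul_left,
        real_inner_smul_right, ht, mul_one, mul_one]
    rw [slope_def_module, slope_def_module, smul_apply, real_inner_smul_left, h1, smul_eq_mul]
  -- derivative of `φ`
  let S : H →L[ℝ] H := T c - l c n • ContinuousLinearMap.id ℝ H + (innerSL ℝ e).smulRight e
  have hSapp : ∀ f, S f = (T c f - l c n • f) + ⟪e, f⟫ • e := fun f => by simp [S]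
  have hS : AntilipschitzWith (Real.toNNReal (min δ 1)⁻¹) S := by
    refine S.antilipschitz_of_bound fun f => ?_
    have hm : 0 < min δ 1 := lt_min hδ one_pos
    rw [Real.coe_toNNReal _ (inv_nonneg.2 hm.le), inv_mul_eq_div, le_div_iff₀' hm]
    have := (b c).norm_le_of_abs_inner_le (f := min δ 1 • f) (g := S f) fun j => by
      rw [hSapp, inner_add_right, (hdiag c).inner_apply_sub_smul, real_inner_smul_right,
        real_inner_smul_right, abs_mul, abs_of_pos hm, he,
        orthonormal_iff_ite.1 (b c).orthonormal]
      split_ifs with hj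
      · subst hj
        simpa using mul_le_mul_of_nonneg_right (min_le_right δ 1) (abs_nonneg ⟪b c j, f⟫)
      · rw [mul_zero, add_zero, abs_mul]
        exact mul_le_mul_of_nonneg_right ((min_le_left δ 1).trans ((hgap j hj).trans
          (abs_abs_sub_abs_le_abs_sub _ _))) (abs_nonneg _)
    rwa [norm_smul, Real.norm_of_nonneg hm.le] at this
  have hSφ : Tendsto (fun t => S (slope φ c t)) (𝓝[≠] c) (𝓝 (⟪T' e, e⟫ • e - T' e)) := by
    refine ((hld.smul hφe').sub hTφ).congr' ?_
    filter_upwards [nhdsWithin_le_nhds hφinner] with t ht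
    have h1 : S (φ t - e) = (l t n - l c n) • φ t - (T t - T c) (φ t) := by
      have h2 : ⟪e, φ t - e⟫ = 0 := by rw [inner_sub_right, real_inner_comm, ht, hee, sub_self]
      rw [hSapp, h2, zero_smul, add_zero, map_sub, hTe, sub_apply, hφeig]
      module
    rw [slope_def_module φ, ContinuousLinearMap.map_smul S, hφc, h1, slope_def_module, slope_def_module, smul_apply,
      smul_eq_mul, mul_smul, smul_sub]
  -- The images of the difference quotients under `S` converge; since `S` is bounded below, the
  -- quotients themselves are Cauchy.
  obtain ⟨w, hw⟩ : ∃ w, Tendsto (slope φ c) (𝓝[≠] c) (𝓝 w) := by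
    refine cauchy_map_iff_exists_tendsto.1 ?_
    rw [← (hS.isUniformInducing S.uniformContinuous).cauchy_map_iff, Filter.map_map]
    exact hSφ.cauchy_map
  have hφd : HasDerivAt φ w c := hasDerivAt_iff_tendsto_slope.2 hw
  have hlam : HasDerivAt (fun t => l t n) ⟪T' e, e⟫ c := hasDerivAt_iff_tendsto_slope.2 hld
  have hlc : l c n ≠ 0 := fun h0 => by simpa [h0] using hsign c
  -- `⟪k t, φ t⟫ / l t n` is continuous at `c` and positive there, whereas the same quotient with `b
  -- t n` is positive for all `t`; so the scaling factor is positive near `c`.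
  have hpos : ∀ᶠ t in 𝓝 c, 0 < s t := by
    have h1 : Tendsto (fun t => ⟪k t, φ t⟫ / l t n) (𝓝 c) (𝓝 (⟪k c, e⟫ / l c n)) :=
      (hk.tendsto.inner hφe).div hlam.continuousAt.tendsto hlc
    filter_upwards [h1.eventually (lt_mem_nhds (hsign c)), hs0] with t ht ht0
    rw [hφ, real_inner_smul_right, mul_div_assoc, mul_pos_iff_of_pos_right (hsign t)] at ht
    exact inv_pos.1 ht
  have hb : (fun t => b t n) =ᶠ[𝓝 c] fun t => ‖φ t‖⁻¹ • φ t := by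
    filter_upwards [hpos] with t ht
    rw [hφ, norm_smul, hnorm, mul_one, norm_inv, Real.norm_of_nonneg ht.le, inv_inv,
      smul_inv_smul₀ ht.ne']
  have hφc0 : φ c ≠ 0 := fun h0 => by
    have := hnorm c
    rw [← he, ← hφc, h0, norm_zero] at this
    exact zero_ne_one this
  have hdn : DifferentiableAt ℝ (fun t => ‖φ t‖⁻¹ • φ t) c :=
    ((hφd.differentiableAt.norm ℝ hφc0).inv (norm_ne_zero_iff.2 hφc0)).smul hφd.differentiableAt
  exact ⟨_, _, hdn.hasDerivAt.congr_of_eventuallyEq hb, hlam⟩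

end EigenPerturbation

/-! ### Compactness of Hilbert–Schmidt operators -/

section HilbertSchmidt

open scoped Topology RealInnerProductSpace

variable {ι H : Type*} [NormedAddCommGroup H] [InnerProductSpace ℝ H]

lemma isCompactOperator_innerSL_smulRight (u v : H) :
    IsCompactOperator ((innerSL ℝ u).smulRight v : H →L[ℝ] H) :=
  (isCompactOperator_of_locallyCompactSpace_rng
    (ContinuousLinearMap.toSpanSingleton ℝ v)).comp_clm (innerSL ℝ u)

/-- Hilbert–Schmidt operators are compact. -/
theorem isCompactOperator_of_sum_norm_sq_le [CompleteSpace H] (b : HilbertBasis ι ℝ H)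
    (A : H →L[ℝ] H) {M : ℝ} (hM : ∀ s : Finset ι, ∑ i ∈ s, ‖A (b i)‖ ^ 2 ≤ M) : IsCompactOperator A := by
  classical
  have hsum : Summable fun i => ‖A (b i)‖ ^ 2 :=
    summable_of_sum_le (fun i => by positivity) hM
  -- Finite-rank truncations. Cauchy–Schwarz and Bessel bound `‖(A - F s) f‖` by `‖f‖` times the
  -- square root of a tail of `∑ ‖A (b i)‖²`, giving convergence in operator norm.
  let F : Finset ι → H →L[ℝ] H := fun s => ∑ i ∈ s, (innerSL ℝ (b i)).smulRight (A (b i))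
  have hFapp : ∀ s f, F s f = ∑ i ∈ s, ⟪b i, f⟫ • A (b i) := fun s f => by
    simp only [F, sum_apply, ContinuousLinearMap.smulRight_apply,
      innerSL_apply_apply]
  have hFc : ∀ s, IsCompactOperator (F s) := fun s =>
    (compactOperator (RingHom.id ℝ) H H).sum_mem fun i _ =>
      isCompactOperator_innerSL_smulRight (b i) (A (b i))
  have hlimf : ∀ f, Tendsto (fun s => F s f) atTop (𝓝 (A f)) := fun f => by
    have := (b.hasSum_repr f).mapL A
    simpa only [map_smul, b.repr_apply_apply, HasSum, SummationFilter.unconditional_filter,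
      ← hFapp] using this
  refine isCompactOperator_of_tendsto (l := atTop) (F := F) ?_ (Eventually.of_forall hFc)
  rw [Metric.tendsto_atTop]
  intro ε hε
  obtain ⟨s₀, hs₀⟩ := summable_iff_vanishing_norm.1 hsum ((ε / 2) ^ 2) (by positivity)
  refine ⟨s₀, fun s hs => ?_⟩
  rw [dist_comm, dist_eq_norm]
  refine lt_of_le_of_lt (ContinuousLinearMap.opNorm_le_bound _ (half_pos hε).le fun f => ?_)
    (half_lt_self hε)
  have hconv : Tendsto (fun t => ‖F t f - F s f‖) atTop (𝓝 ‖(A - F s) f‖) :=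
    ((hlimf f).sub_const _).norm
  refine le_of_tendsto hconv ?_
  filter_upwards [eventually_ge_atTop s] with t hst
  have hdiff : F t f - F s f = ∑ i ∈ t \ s, ⟪b i, f⟫ • A (b i) := by
    rw [hFapp, hFapp, ← Finset.sum_sdiff hst, add_sub_cancel_right]
  have hA := hs₀ (t \ s) (Finset.disjoint_of_subset_right hs Finset.sdiff_disjoint)
  have hB : ∑ i ∈ t \ s, |⟪b i, f⟫| ^ 2 ≤ ‖f‖ ^ 2 := b.orthonormal.sum_inner_products_le f
  rw [hdiff]
  refine abs_le_of_sq_le_sq' ?_ (by positivity) |>.2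
  calc ‖∑ i ∈ t \ s, ⟪b i, f⟫ • A (b i)‖ ^ 2
      ≤ (∑ i ∈ t \ s, |⟪b i, f⟫| * ‖A (b i)‖) ^ 2 := by
        gcongr
        refine (norm_sum_le _ _).trans_eq (Finset.sum_congr rfl fun i _ => ?_)
        rw [norm_smul, Real.norm_eq_abs]
    _ ≤ (∑ i ∈ t \ s, |⟪b i, f⟫| ^ 2) * ∑ i ∈ t \ s, ‖A (b i)‖ ^ 2 :=
        Finset.sum_mul_sq_le_sq_mul_sq _ _ _
    _ ≤ ‖f‖ ^ 2 * (ε / 2) ^ 2 := by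
        gcongr
        exact (le_abs_self _).trans hA.le
    _ = (ε / 2 * ‖f‖) ^ 2 := by ring

end HilbertSchmidt

/-! ### Hankel operators on `L²[0, ∞)` -/

section HankelOperator

open scoped Topology RealInnerProductSpace

/-- The space `L²[0, ∞)`. -/
abbrev HalfLineL2 : Type := Lp ℝ 2 (volume.restrict (Ioi (0 : ℝ)))

variable {a : ℝ → ℝ}

lemma halfLineL2_memLp (f : HalfLineL2) : MemLp f 2 (volume.restrict (Ioi (0 : ℝ))) := Lp.memLp f

lemma halfLineL2_inner (f g : HalfLineL2) : ⟪f, g⟫ = ∫ x in Ioi (0 : ℝ), f x * g x := by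
  rw [L2.inner_def]
  simp only [RCLike.inner_apply, conj_trivial, mul_comm]

/-- An exponentially decaying function as an element of `L²[0, ∞)`. -/
noncomputable def IsExpKernel.toL2 (ha : IsExpKernel 1 a) : HalfLineL2 := (ha.memLp one_pos).toLp a

lemma IsExpKernel.coeFn_toL2 (ha : IsExpKernel 1 a) :
    ha.toL2 =ᵐ[volume.restrict (Ioi (0 : ℝ))] a := MemLp.coeFn_toLp _

lemma IsExpKernel.inner_toL2 (ha : IsExpKernel 1 a) (f : HalfLineL2) :
    ⟪ha.toL2, f⟫ = ∫ x in Ioi (0 : ℝ), a x * f x := by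
  rw [halfLineL2_inner]
  exact integral_congr_ae (ha.coeFn_toL2.mono fun x hx => by simp only [hx])

/-- `exp (-x)` as an element of `L²[0, ∞)`. -/
noncomputable def expL2 : HalfLineL2 := (isExpKernel_exp 1).toL2

lemma IsExpKernel.norm_toL2_le (ha : IsExpKernel 1 a) {C : ℝ}
    (h : ∀ z, 0 ≤ z → |a z| ≤ C * Real.exp (-z)) : ‖ha.toL2‖ ≤ C * ‖expL2‖ := by
  refine Lp.norm_le_mul_norm_of_ae_le_mul ?_
  filter_upwards [ha.coeFn_toL2, (isExpKernel_exp 1).coeFn_toL2,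
    ae_restrict_mem measurableSet_Ioi] with x h1 h2 hx
  rw [h1, expL2, h2, one_mul, Real.norm_eq_abs, Real.norm_of_nonneg (Real.exp_nonneg _)]
  exact h x (le_of_lt hx)

lemma IsExpKernel.abs_hankel_le (ha : IsExpKernel 1 a) {C : ℝ}
    (h : ∀ z, 0 ≤ z → |a z| ≤ C * Real.exp (-z)) (f : HalfLineL2) {x : ℝ} (hx : 0 ≤ x) :
    |hankel a f x| ≤ C * ‖expL2‖ * ‖f‖ * Real.exp (-x) := by
  have hs : IsExpKernel 1 fun y => a (x + y) := by simpa only [add_comm x] using ha.comp_add x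
  have e : hankel a f x = ⟪hs.toL2, f⟫ := (hs.inner_toL2 f).symm
  have hn := hs.norm_toL2_le (C := C * Real.exp (-x)) fun z hz => by
    rw [mul_assoc, ← Real.exp_add, ← neg_add]
    exact h _ (add_nonneg hx hz)
  rw [e]
  calc _ ≤ ‖hs.toL2‖ * ‖f‖ := abs_real_inner_le_norm _ _
    _ ≤ C * Real.exp (-x) * ‖expL2‖ * ‖f‖ := by gcongr
    _ = _ := by ring

lemma IsExpKernel.continuous_hankel (ha : IsExpKernel 1 a) (f : HalfLineL2) :
    Continuous (hankel a f) := by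
  obtain ⟨C, hC, h⟩ := ha.bound
  have hf := (halfLineL2_memLp f).integrable_exp_mul one_pos
  refine continuous_iff_continuousAt.2 fun x => continuousAt_of_dominated
    (bound := fun y => C * Real.exp (-(1 * (x - 1))) * ‖Real.exp (-(1 * y)) * f y‖) ?_ ?_ ?_ ?_
  · exact Eventually.of_forall fun s => (ha.integrable_hankel hf s).aestronglyMeasurable
  · filter_upwards [Ioi_mem_nhds (sub_one_lt x)] with s hs
    refine Eventually.of_forall fun y => ?_
    have hs' : x - 1 < s := hs
    rw [norm_mul, norm_mul, Real.norm_of_nonneg (Real.exp_nonneg _), ← mul_assoc]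
    refine mul_le_mul_of_nonneg_right ((h (s + y)).trans ?_) (norm_nonneg _)
    rw [mul_assoc, ← Real.exp_add]
    gcongr
    linarith
  · exact hf.norm.const_mul _
  · exact Eventually.of_forall fun y => ((ha.continuous.comp
      (continuous_id.add continuous_const)).mul continuous_const).continuousAt

lemma IsExpKernel.isExpKernel_hankel (ha : IsExpKernel 1 a) (f : HalfLineL2) :
    IsExpKernel 1 (hankel a f) :=
  ⟨ha.continuous_hankel f, ha.hankel_bound ((halfLineL2_memLp f).integrable_exp_mul one_pos)⟩

lemma hankel_congr_ae {f g : ℝ → ℝ} (h : f =ᵐ[volume.restrict (Ioi (0 : ℝ))] g) :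
    hankel a f = hankel a g :=
  funext fun _ => integral_congr_ae (h.mono fun y hy => by simp only [hy])

/-- `A` is the integral operator on `L²[0, ∞)` with kernel `a (x + y)`. -/
def IsHankelOp (A : HalfLineL2 →L[ℝ] HalfLineL2) (a : ℝ → ℝ) : Prop :=
  ∀ f : HalfLineL2, A f =ᵐ[volume.restrict (Ioi (0 : ℝ))] hankel a f

lemma norm_le_of_ae_eq_hankel (ha : IsExpKernel 1 a) {C : ℝ}
    (h : ∀ z, 0 ≤ z → |a z| ≤ C * Real.exp (-z)) {f g : HalfLineL2}
    (hg : g =ᵐ[volume.restrict (Ioi (0 : ℝ))] hankel a f) :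
    ‖g‖ ≤ C * ‖expL2‖ ^ 2 * ‖f‖ := by
  have : ‖g‖ ≤ C * ‖expL2‖ * ‖f‖ * ‖expL2‖ := by
    refine Lp.norm_le_mul_norm_of_ae_le_mul ?_
    filter_upwards [hg, (isExpKernel_exp 1).coeFn_toL2,
      ae_restrict_mem measurableSet_Ioi] with x h1 h2 hx
    rw [h1, expL2, h2, one_mul, Real.norm_eq_abs, Real.norm_of_nonneg (Real.exp_nonneg _)]
    exact ha.abs_hankel_le h f (le_of_lt hx)
  linarith

lemma IsExpKernel.nonneg_of_bound {C : ℝ} (h : ∀ z, 0 ≤ z → |a z| ≤ C * Real.exp (-z)) : 0 ≤ C := by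
  simpa using (abs_nonneg _).trans (h 0 le_rfl)

lemma IsHankelOp.norm_le {A : HalfLineL2 →L[ℝ] HalfLineL2} (hA : IsHankelOp A a)
    (ha : IsExpKernel 1 a) {C : ℝ} (h : ∀ z, 0 ≤ z → |a z| ≤ C * Real.exp (-z)) :
    ‖A‖ ≤ C * ‖expL2‖ ^ 2 :=
  have := IsExpKernel.nonneg_of_bound h
  A.opNorm_le_bound (by positivity) fun f => norm_le_of_ae_eq_hankel ha h (hA f)

lemma hankel_add (ha : IsExpKernel 1 a) {f g : ℝ → ℝ}
    (hf : MemLp f 2 (volume.restrict (Ioi (0 : ℝ))))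
    (hg : MemLp g 2 (volume.restrict (Ioi (0 : ℝ)))) (x : ℝ) :
    hankel a (f + g) x = hankel a f x + hankel a g x := by
  simp only [hankel, Pi.add_apply, mul_add]
  exact integral_add (ha.integrable_hankel (hf.integrable_exp_mul one_pos) x)
    (ha.integrable_hankel (hg.integrable_exp_mul one_pos) x)

lemma hankel_smul (r : ℝ) (f : ℝ → ℝ) (x : ℝ) : hankel a (r • f) x = r * hankel a f x := by
  simp only [hankel, Pi.smul_apply, smul_eq_mul, mul_left_comm, integral_const_mul]

lemma exists_isHankelOp (ha : IsExpKernel 1 a) : ∃ A, IsHankelOp A a := by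
  obtain ⟨C, hC, h⟩ := ha.bound
  have hmem := fun f : HalfLineL2 => (ha.isExpKernel_hankel f).coeFn_toL2
  let L : HalfLineL2 →ₗ[ℝ] HalfLineL2 :=
    { toFun := fun f => (ha.isExpKernel_hankel f).toL2
      map_add' := fun f g => by
        refine Lp.ext ?_
        filter_upwards [hmem (f + g), hmem f, hmem g,
          Lp.coeFn_add (ha.isExpKernel_hankel f).toL2 (ha.isExpKernel_hankel g).toL2]
          with x h1 h2 h3 h4
        rw [h1, h4, Pi.add_apply, h2, h3, hankel_congr_ae (Lp.coeFn_add f g),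
          hankel_add ha (halfLineL2_memLp f) (halfLineL2_memLp g)]
      map_smul' := fun r f => by
        refine Lp.ext ?_
        filter_upwards [hmem (r • f), hmem f,
          Lp.coeFn_smul r (ha.isExpKernel_hankel f).toL2] with x h1 h2 h3
        rw [h1, RingHom.id_apply, h3, Pi.smul_apply, h2, hankel_congr_ae (Lp.coeFn_smul r f),
          hankel_smul, smul_eq_mul] }
  exact ⟨L.mkContinuous (C * ‖expL2‖ ^ 2) fun f => norm_le_of_ae_eq_hankel ha
    (fun z _ => by simpa using h z) (hmem f), hmem⟩

/-- The integral operator on `L²[0, ∞)` with kernel `a (x + y)`. -/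
noncomputable def hankelOp (ha : IsExpKernel 1 a) : HalfLineL2 →L[ℝ] HalfLineL2 :=
  (exists_isHankelOp ha).choose

lemma hankelOp_spec (ha : IsExpKernel 1 a) : IsHankelOp (hankelOp ha) a :=
  (exists_isHankelOp ha).choose_spec

lemma hankelOp_symm (ha : IsExpKernel 1 a) (f g : HalfLineL2) :
    ⟪hankelOp ha f, g⟫ = ⟪f, hankelOp ha g⟫ := by
  rw [halfLineL2_inner, halfLineL2_inner]
  calc _ = ∫ x in Ioi (0 : ℝ), hankel a f x * g x :=
        integral_congr_ae ((hankelOp_spec ha f).mono fun x hx => by simp only [hx])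
    _ = ∫ x in Ioi (0 : ℝ), f x * hankel a g x := ha.integral_hankel_mul
        ((halfLineL2_memLp f).integrable_exp_mul one_pos)
        ((halfLineL2_memLp g).integrable_exp_mul one_pos)
    _ = _ := integral_congr_ae ((hankelOp_spec ha g).mono fun x hx => by simp only [hx])

/-- The value of the transform of `b i` at `x` is a coordinate of `a (x + ·)`, so Bessel's
inequality for each `x`, integrated over `x`, bounds the Hilbert–Schmidt sum. -/
lemma isCompactOperator_hankelOp (ha : IsExpKernel 1 a) : IsCompactOperator (hankelOp ha) := by
  obtain ⟨C, hC, h⟩ := ha.bound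
  obtain ⟨w, b, -⟩ := exists_hilbertBasis ℝ HalfLineL2
  have hx : ∀ x, IsExpKernel 1 fun y => a (x + y) := fun x => by
    simpa only [add_comm x] using ha.comp_add x
  have hn : ∀ x, ‖(hx x).toL2‖ ≤ C * Real.exp (-x) * ‖expL2‖ := fun x =>
    (hx x).norm_toL2_le fun z _ => (h _).trans_eq (by rw [mul_assoc, ← Real.exp_add]; ring_nf)
  have hexp := (isExpKernel_exp 1).integrable_mul (isExpKernel_exp 1)
  refine isCompactOperator_of_sum_norm_sq_le b (hankelOp ha)
    (M := ∫ x in Ioi (0 : ℝ), (C * ‖expL2‖) ^ 2 * (Real.exp (-(1 * x)) * Real.exp (-(1 * x))))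
    fun s => ?_
  have hi : ∀ i, IntegrableOn (fun x => hankel a (b i) x * hankel a (b i) x) (Ioi 0) := fun i =>
    (ha.isExpKernel_hankel (b i)).integrable_mul (ha.isExpKernel_hankel (b i))
  have e : ∀ i, ‖hankelOp ha (b i)‖ ^ 2
      = ∫ x in Ioi (0 : ℝ), hankel a (b i) x * hankel a (b i) x := fun i => by
    rw [← real_inner_self_eq_norm_sq, halfLineL2_inner]
    exact integral_congr_ae ((hankelOp_spec ha (b i)).mono fun x hx => by simp only [hx])
  simp_rw [e]
  rw [← integral_finsetSum _ fun i _ => hi i]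
  refine integral_mono (integrable_finsetSum _ fun i _ => hi i) (hexp.const_mul _) fun x => ?_
  calc ∑ i ∈ s, hankel a (b i) x * hankel a (b i) x
      = ∑ i ∈ s, ‖⟪b i, (hx x).toL2⟫‖ ^ 2 := by
        refine Finset.sum_congr rfl fun i _ => ?_
        rw [real_inner_comm, (hx x).inner_toL2, Real.norm_eq_abs, sq_abs, sq, hankel]
    _ ≤ ‖(hx x).toL2‖ ^ 2 := b.orthonormal.sum_inner_products_le _
    _ ≤ (C * Real.exp (-x) * ‖expL2‖) ^ 2 := by gcongr; exact hn x
    _ = _ := by simp only [one_mul]; ring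

end HankelOperator

/-! ### Differentiability of the Airy operator in `c` -/

open scoped Topology RealInnerProductSpace

lemma abs_sub_sub_mul_deriv_le {u u' u'' : ℝ → ℝ} (hu : ∀ z, HasDerivAt u (u' z) z)
    (hu' : ∀ z, HasDerivAt u' (u'' z) z) {z h B : ℝ} (hB : ∀ s ∈ uIcc z (z + h), |u'' s| ≤ B) :
    |u (z + h) - u z - h * u' z| ≤ B * h ^ 2 := by
  have hB0 : 0 ≤ B := (abs_nonneg _).trans (hB z left_mem_uIcc)
  have h1 : ∀ s ∈ uIcc z (z + h), |u' s - u' z| ≤ B * |h| := fun s hs => by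
    have := (convex_uIcc z (z + h)).norm_image_sub_le_of_norm_hasDerivWithin_le
      (fun x _ => (hu' x).hasDerivWithinAt) hB left_mem_uIcc hs
    refine this.trans (mul_le_mul_of_nonneg_left ?_ hB0)
    have := abs_sub_left_of_mem_uIcc hs
    simpa using this
  have hd : ∀ x ∈ uIcc z (z + h), HasDerivWithinAt (fun x => u x - x * u' z) (u' x - u' z)
      (uIcc z (z + h)) x := fun x _ => by
    have := (hu x).sub ((hasDerivAt_id x).mul_const (u' z))
    rw [one_mul] at this
    exact this.hasDerivWithinAt
  have h2 := (convex_uIcc z (z + h)).norm_image_sub_le_of_norm_hasDerivWithin_le hd h1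
    left_mem_uIcc right_mem_uIcc
  have e : u (z + h) - (z + h) * u' z - (u z - z * u' z) = u (z + h) - u z - h * u' z := by ring
  rw [e, add_sub_cancel_left, Real.norm_eq_abs, Real.norm_eq_abs, mul_assoc, ← sq, sq_abs] at h2
  exact h2

/-- The Taylor remainder in `c` keeps the weight `exp (-z)`, so one estimate serves for the `L²`
norm of the kernel function and for the operator norm. -/
lemma exists_abs_airyKernel_sub_le (c : ℝ) (k : ℕ) : ∃ C, 0 ≤ C ∧ ∀ t, |t - c| ≤ 1 → ∀ z,
    |airyKernel t k z - airyKernel c k z - (t - c) * airyKernel c (k + 1) z|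
      ≤ C * (t - c) ^ 2 * Real.exp (-z) := by
  obtain ⟨C, hC, hb⟩ := exists_abs_airyDeriv_le (k + 2) one_pos
  -- Intermediate points satisfy `s ≥ z + c - 1`, whence `exp (-s) ≤ exp (1 - c) exp (-z)`.
  refine ⟨C * Real.exp (1 - c), by positivity, fun t ht z => ?_⟩
  have h := abs_sub_sub_mul_deriv_le (hasDerivAt_airyDeriv k) (hasDerivAt_airyDeriv (k + 1))
    (z := z + c) (h := t - c) (B := C * Real.exp (1 - c - z)) fun s hs => by
      refine (hb s).trans ?_
      gcongr
      have h1 := abs_sub_left_of_mem_uIcc hs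
      rw [add_sub_cancel_left] at h1
      have := (abs_le.1 (h1.trans ht)).1
      linarith
  rw [show z + c + (t - c) = z + t by ring] at h
  refine h.trans_eq ?_
  rw [sub_eq_add_neg (1 - c), Real.exp_add]; ring

lemma hasDerivAt_of_norm_sub_le_sq {E : Type*} [NormedAddCommGroup E] [NormedSpace ℝ E]
    {u : ℝ → E} {u' : E} {c K : ℝ}
    (h : ∀ t, |t - c| ≤ 1 → ‖u t - u c - (t - c) • u'‖ ≤ K * (t - c) ^ 2) : HasDerivAt u u' c := by
  rw [hasDerivAt_iff_isLittleO]
  have h1 : (fun t => u t - u c - (t - c) • u') =O[𝓝 c] fun t => (t - c) ^ 2 := by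
    refine Asymptotics.IsBigO.of_bound K ?_
    filter_upwards [Metric.closedBall_mem_nhds c one_pos] with t ht
    rw [Real.norm_of_nonneg (sq_nonneg _)]
    exact h t (by simpa [Real.dist_eq] using ht)
  refine h1.trans_isLittleO ?_
  have h2 : (fun t : ℝ => t - c) =o[𝓝 c] fun _ => (1 : ℝ) := by
    rw [Asymptotics.isLittleO_one_iff]
    have : Continuous fun t : ℝ => t - c := by fun_prop
    simpa using this.tendsto c
  simpa [sq] using h2.mul_isBigO (Asymptotics.isBigO_refl (fun t : ℝ => t - c) (𝓝 c))

lemma isExpKernel_one_airyKernel (c : ℝ) (k : ℕ) : IsExpKernel 1 (airyKernel c k) :=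
  isExpKernel_airyKernel c k one_pos

/-- The Airy operator on `L²[0, ∞)` and, for `k > 0`, its derivatives in `c`. -/
noncomputable def airyL2Op (k : ℕ) (c : ℝ) : HalfLineL2 →L[ℝ] HalfLineL2 :=
  hankelOp (isExpKernel_one_airyKernel c k)

/-- The kernel function of the Airy operator as an element of `L²[0, ∞)`. -/
noncomputable def airyL2 (k : ℕ) (c : ℝ) : HalfLineL2 := (isExpKernel_one_airyKernel c k).toL2

lemma isExpKernel_airyKernel_sub (t c : ℝ) (k : ℕ) : IsExpKernel 1 fun z =>
    airyKernel t k z - airyKernel c k z - (t - c) * airyKernel c (k + 1) z := by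
  have := ((isExpKernel_one_airyKernel t k).add
    ((isExpKernel_one_airyKernel c k).const_mul (-1))).add
    ((isExpKernel_one_airyKernel c (k + 1)).const_mul (-(t - c)))
  convert this using 2
  ring

lemma hasDerivAt_airyL2 (k : ℕ) (c : ℝ) : HasDerivAt (airyL2 k) (airyL2 (k + 1) c) c := by
  obtain ⟨C, hC, hb⟩ := exists_abs_airyKernel_sub_le c k
  refine hasDerivAt_of_norm_sub_le_sq (K := C * ‖expL2‖) fun t ht => ?_
  have e : airyL2 k t - airyL2 k c - (t - c) • airyL2 (k + 1) c
      = (isExpKernel_airyKernel_sub t c k).toL2 := by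
    refine Lp.ext ?_
    filter_upwards [(isExpKernel_airyKernel_sub t c k).coeFn_toL2,
      (isExpKernel_one_airyKernel t k).coeFn_toL2, (isExpKernel_one_airyKernel c k).coeFn_toL2,
      (isExpKernel_one_airyKernel c (k + 1)).coeFn_toL2,
      Lp.coeFn_sub (airyL2 k t - airyL2 k c) ((t - c) • airyL2 (k + 1) c),
      Lp.coeFn_sub (airyL2 k t) (airyL2 k c), Lp.coeFn_smul (t - c) (airyL2 (k + 1) c)]
      with x h1 h2 h3 h4 h5 h6 h7
    rw [h1, h5, Pi.sub_apply, h6, Pi.sub_apply, h7, Pi.smul_apply, airyL2, h2, airyL2, h3, airyL2,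
      h4, smul_eq_mul]
  rw [e]
  refine ((isExpKernel_airyKernel_sub t c k).norm_toL2_le fun z _ => hb t ht z).trans_eq ?_
  ring

lemma hankel_airyKernel_sub (t c : ℝ) (k : ℕ) (f : HalfLineL2) (x : ℝ) :
    hankel (fun z => airyKernel t k z - airyKernel c k z - (t - c) * airyKernel c (k + 1) z) f x
      = hankel (airyKernel t k) f x - hankel (airyKernel c k) f x
        - (t - c) * hankel (airyKernel c (k + 1)) f x := by
  have hi := fun (c : ℝ) (k : ℕ) => (isExpKernel_one_airyKernel c k).integrable_hankel
    ((halfLineL2_memLp f).integrable_exp_mul one_pos) x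
  simp only [hankel]
  rw [← integral_const_mul, ← integral_sub (hi t k) (hi c k),
    ← integral_sub (f := fun y => airyKernel t k (x + y) * f y - airyKernel c k (x + y) * f y)
      ((hi t k).sub (hi c k)) ((hi c (k + 1)).const_mul _)]
  refine integral_congr_ae (Eventually.of_forall fun y => ?_)
  simp only; ring

lemma hasDerivAt_airyL2Op (k : ℕ) (c : ℝ) : HasDerivAt (airyL2Op k) (airyL2Op (k + 1) c) c := by
  obtain ⟨C, hC, hb⟩ := exists_abs_airyKernel_sub_le c k
  refine hasDerivAt_of_norm_sub_le_sq (K := C * ‖expL2‖ ^ 2) fun t ht => ?_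
  have hA : IsHankelOp (airyL2Op k t - airyL2Op k c - (t - c) • airyL2Op (k + 1) c)
      (fun z => airyKernel t k z - airyKernel c k z - (t - c) * airyKernel c (k + 1) z) := by
    intro f
    have e : (airyL2Op k t - airyL2Op k c - (t - c) • airyL2Op (k + 1) c) f
      = airyL2Op k t f - airyL2Op k c f - (t - c) • airyL2Op (k + 1) c f := rfl
    rw [e]
    filter_upwards [hankelOp_spec (isExpKernel_one_airyKernel t k) f,
      hankelOp_spec (isExpKernel_one_airyKernel c k) f,
      hankelOp_spec (isExpKernel_one_airyKernel c (k + 1)) f,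
      Lp.coeFn_sub (airyL2Op k t f - airyL2Op k c f) ((t - c) • airyL2Op (k + 1) c f),
      Lp.coeFn_sub (airyL2Op k t f) (airyL2Op k c f),
      Lp.coeFn_smul (t - c) (airyL2Op (k + 1) c f)] with x h2 h3 h4 h5 h6 h7
    rw [hankel_airyKernel_sub, h5, Pi.sub_apply, h6, Pi.sub_apply, h7, Pi.smul_apply, airyL2Op, h2,
      airyL2Op, h3, airyL2Op, h4, smul_eq_mul]
  refine (hA.norm_le (isExpKernel_airyKernel_sub t c k) fun z _ => hb t ht z).trans_eq ?_
  ring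

/-- Point values become inner products with a vector that moves differentiably; this turns `L²`
differentiability in `c` into pointwise differentiability. -/
lemma hankel_airyKernel_eq_inner (c : ℝ) (k : ℕ) (f : HalfLineL2) (x : ℝ) :
    hankel (airyKernel c k) f x = ⟪airyL2 k (x + c), f⟫ := by
  rw [airyL2, IsExpKernel.inner_toL2, hankel]
  simp only [airyKernel, add_assoc, add_comm x, add_left_comm]

lemma eq_zero_of_ae_eq_zero_of_continuous {u : ℝ → ℝ} (hu : Continuous u)
    (h : u =ᵐ[volume.restrict (Ioi (0 : ℝ))] 0) {x : ℝ} (hx : 0 ≤ x) : u x = 0 := by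
  have h1 : EqOn u 0 (Ioi 0) := Measure.eqOn_open_of_ae_eq h isOpen_Ioi hu.continuousOn
    continuousOn_const
  have h2 := h1.closure hu continuous_const
  rw [closure_Ioi] at h2
  exact h2 hx

lemma airyL2Op_injective (c : ℝ) {f : HalfLineL2} (h : airyL2Op 0 c f = 0) : f = 0 := by
  have hK := isExpKernel_one_airyKernel c 0
  refine (Lp.eq_zero_iff_ae_eq_zero).2 (ae_eq_zero_of_airyOp_eq_zero (c := c)
    (halfLineL2_memLp f) fun x hx => ?_)
  rw [airyOp_eq_hankel]
  refine eq_zero_of_ae_eq_zero_of_continuous (hK.continuous_hankel f) ?_ hx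
  filter_upwards [hankelOp_spec hK f, Lp.coeFn_zero ℝ 2 (volume.restrict (Ioi (0 : ℝ)))] with x h1 h2
  rw [← h1]
  rw [airyL2Op] at h
  rw [h, h2]

/-! ### Completeness of the eigenfunctions -/

namespace IsAiryEigensystem

variable {c : ℝ} {lam : ℕ → ℝ} {psi : ℕ → ℝ → ℝ}

/-- The eigenfunctions as elements of `L²[0, ∞)`. -/
noncomputable def vec (h : IsAiryEigensystem c lam psi) (j : ℕ) : HalfLineL2 :=
  (h.eigen j).1.toLp (psi j)

lemma coeFn_vec (h : IsAiryEigensystem c lam psi) (j : ℕ) :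
    h.vec j =ᵐ[volume.restrict (Ioi (0 : ℝ))] psi j := MemLp.coeFn_toLp _

lemma orthonormal_vec (h : IsAiryEigensystem c lam psi) : Orthonormal ℝ h.vec := by
  rw [orthonormal_iff_ite]
  intro i j
  rw [halfLineL2_inner, ← h.integral_mul_eq_ite i j]
  refine integral_congr_ae ?_
  filter_upwards [h.coeFn_vec i, h.coeFn_vec j] with x h1 h2
  rw [h1, h2]

lemma hankel_vec (h : IsAiryEigensystem c lam psi) (j : ℕ) {x : ℝ} (hx : 0 ≤ x) :
    hankel (airyKernel c 0) (h.vec j) x = lam j * psi j x := by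
  rw [hankel_congr_ae (h.coeFn_vec j), (h.eigen j).2 x hx, airyOp_eq_hankel]

lemma airyL2Op_vec (h : IsAiryEigensystem c lam psi) (j : ℕ) :
    airyL2Op 0 c (h.vec j) = lam j • h.vec j := by
  refine Lp.ext ?_
  filter_upwards [hankelOp_spec (isExpKernel_one_airyKernel c 0) (h.vec j),
    Lp.coeFn_smul (lam j) (h.vec j), h.coeFn_vec j, ae_restrict_mem measurableSet_Ioi]
    with x h1 h2 h3 hx
  rw [airyL2Op, h1, h2, Pi.smul_apply, h3, h.hankel_vec j (le_of_lt hx), smul_eq_mul]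

/-- An `L²` class in the eigenspace of `μ ≠ 0` is represented by `eigenDeriv c μ g 0`, which
satisfies the eigenvalue equation at every `x ≥ 0`, so the basis condition applies to it. -/
lemma eigenspace_le_span (h : IsAiryEigensystem c lam psi) (μ : ℝ) :
    Module.End.eigenspace (airyL2Op 0 c : Module.End ℝ HalfLineL2) μ
      ≤ Submodule.span ℝ (range h.vec) := by
  intro g hg
  have hg' : airyL2Op 0 c g = μ • g := Module.End.mem_eigenspace_iff.1 hg
  have hK := isExpKernel_one_airyKernel c 0
  rcases eq_or_ne μ 0 with rfl | hμ
  · rw [airyL2Op_injective c (f := g) (by rw [hg', zero_smul])]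
    exact Submodule.zero_mem _
  · have hgf : g =ᵐ[volume.restrict (Ioi (0 : ℝ))] eigenDeriv c μ g 0 := by
      filter_upwards [hankelOp_spec hK g, Lp.coeFn_smul μ g] with x h1 h2
      rw [airyL2Op] at hg'
      rw [eigenDeriv, ← h1, hg', h2, Pi.smul_apply, smul_eq_mul, inv_mul_cancel_left₀ hμ]
    have hmem : MemAiryEigenspace c μ (eigenDeriv c μ g 0) :=
      ⟨(isExpKernel_eigenDeriv (halfLineL2_memLp g) 0).memLp one_pos, fun x _ => by
        rw [airyOp_eq_hankel, ← hankel_congr_ae hgf, eigenDeriv, mul_inv_cancel_left₀ hμ]⟩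
    obtain ⟨a, ha, -⟩ := h.basis μ _ hmem
    have e : g = ∑ j ∈ a.support, a j • h.vec j := by
      refine Lp.ext ?_
      have hv : ∀ᵐ x ∂volume.restrict (Ioi (0 : ℝ)), ∀ j ∈ a.support,
          (a j • h.vec j : HalfLineL2) x = a j * psi j x := by
        rw [eventually_all_finset]
        intro j _
        filter_upwards [Lp.coeFn_smul (a j) (h.vec j), h.coeFn_vec j] with x h1 h2
        rw [h1, Pi.smul_apply, h2, smul_eq_mul]
      filter_upwards [hgf, ha, hv, Lp.coeFn_finsetSum a.support fun j => a j • h.vec j]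
        with x h1 h2 h3 h4
      rw [h1, h2, h4, Finset.sum_apply, Finsupp.sum]
      exact (Finset.sum_congr rfl h3).symm
    rw [e]
    exact Submodule.sum_mem _ fun j _ => Submodule.smul_mem _ _ (Submodule.subset_span ⟨_, rfl⟩)

lemma orthogonal_span_vec (h : IsAiryEigensystem c lam psi) :
    (Submodule.span ℝ (range h.vec))ᗮ = ⊥ := by
  have := ContinuousLinearMap.orthogonalComplement_iSup_eigenspaces_eq_bot
    (isCompactOperator_hankelOp (isExpKernel_one_airyKernel c 0)) (hankelOp_symm _)
  rw [eq_bot_iff, ← this]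
  exact Submodule.orthogonal_le (iSup_le fun μ => h.eigenspace_le_span μ)

/-- The Hilbert basis of eigenfunctions. -/
noncomputable def hilbertBasis (h : IsAiryEigensystem c lam psi) : HilbertBasis ℕ ℝ HalfLineL2 :=
  HilbertBasis.mkOfOrthogonalEqBot h.orthonormal_vec h.orthogonal_span_vec

lemma hilbertBasis_apply (h : IsAiryEigensystem c lam psi) (j : ℕ) : h.hilbertBasis j = h.vec j :=
  congrFun (HilbertBasis.coe_mkOfOrthogonalEqBot _ _) j

lemma isDiagonalIn (h : IsAiryEigensystem c lam psi) :
    IsDiagonalIn (airyL2Op 0 c) h.hilbertBasis lam where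
  symm := hankelOp_symm _
  eigen j := by rw [hilbertBasis_apply, airyL2Op_vec]

lemma apply_eq_inner (h : IsAiryEigensystem c lam psi) (j : ℕ) {x : ℝ} (hx : 0 ≤ x) :
    psi j x = (lam j)⁻¹ * ⟪airyL2 0 (x + c), h.vec j⟫ := by
  rw [← hankel_airyKernel_eq_inner, h.hankel_vec j hx, inv_mul_cancel_left₀ (h.lam_ne_zero j)]

end IsAiryEigensystem

/-! ### Differentiation of the eigenfunctions in `c` -/

section Family

variable {lam : ℝ → ℕ → ℝ} {psi : ℝ → ℕ → ℝ → ℝ}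

lemma exists_hasDerivAt_vec (h : ∀ c : ℝ, IsAiryEigensystem c (lam c) (psi c)) (c : ℝ) (n : ℕ) :
    ∃ (w : HalfLineL2) (l' : ℝ), HasDerivAt (fun t => (h t).vec n) w c ∧
      HasDerivAt (fun t => lam t n) l' c := by
  have := exists_hasDerivAt_eigenvector (fun t => (h t).isDiagonalIn)
    (fun t => (h t).strictAnti_abs) (hasDerivAt_airyL2Op 0 c) n (k := airyL2 0)
    (hasDerivAt_airyL2 0 c).continuousAt (fun t => by
      have h0 := (h t).apply_eq_inner n le_rfl
      rw [zero_add] at h0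
      rw [IsAiryEigensystem.hilbertBasis_apply, div_eq_inv_mul, ← h0]
      exact (h t).pos_zero n)
  simpa only [IsAiryEigensystem.hilbertBasis_apply] using this

/-- The eigenfunctions are differentiable in `c`, both in `L²[0, ∞)` and pointwise, with the same
derivative. -/
theorem exists_deriv_eigenfunction (h : ∀ c : ℝ, IsAiryEigensystem c (lam c) (psi c)) (c : ℝ)
    (n : ℕ) : ∃ (w : HalfLineL2) (l' : ℝ),
      airyL2Op 1 c ((h c).vec n) + airyL2Op 0 c w = l' • (h c).vec n + lam c n • w ∧
      (∀ x, 0 ≤ x → DifferentiableAt ℝ (fun t => psi t n x) c) ∧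
      w =ᵐ[volume.restrict (Ioi (0 : ℝ))] fun x => deriv (fun t => psi t n x) c := by
  obtain ⟨w, l', hw, hl⟩ := exists_hasDerivAt_vec h c n
  have hln := (h c).lam_ne_zero n
  have hrel : airyL2Op 1 c ((h c).vec n) + airyL2Op 0 c w = l' • (h c).vec n + lam c n • w := by
    have h1 := (hasDerivAt_airyL2Op 0 c).clm_apply hw
    have h2 := hl.smul hw
    have e : (fun t => airyL2Op 0 t ((h t).vec n)) = fun t => lam t n • (h t).vec n :=
      funext fun t => (h t).airyL2Op_vec n
    rw [e] at h1
    rw [h1.unique h2, add_comm]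
  have hd : ∀ x, 0 ≤ x → HasDerivAt (fun t => psi t n x)
      (-l' / lam c n ^ 2 * ⟪airyL2 0 (x + c), (h c).vec n⟫ + (lam c n)⁻¹ *
        (⟪airyL2 0 (x + c), w⟫ + ⟪airyL2 1 (x + c), (h c).vec n⟫)) c := fun x hx => by
    have e : (fun t => psi t n x) = fun t => (lam t n)⁻¹ * ⟪airyL2 0 (x + t), (h t).vec n⟫ :=
      funext fun t => (h t).apply_eq_inner n hx
    rw [e]
    exact (hl.inv hln).mul (((hasDerivAt_airyL2 0 (x + c)).comp_const_add x c).inner ℝ hw)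
  refine ⟨w, l', hrel, fun x hx => (hd x hx).differentiableAt, ?_⟩
  -- Solving the differentiated eigenvalue equation for `w` expresses it through integral operators,
  -- whose values agree a.e. with the pointwise derivative found in `hd`.
  have hw' : w = (lam c n)⁻¹ • (airyL2Op 1 c ((h c).vec n) + airyL2Op 0 c w - l' • (h c).vec n) := by
    rw [hrel, add_sub_cancel_left, inv_smul_smul₀ hln]
  have hae : ((lam c n)⁻¹ • (airyL2Op 1 c ((h c).vec n) + airyL2Op 0 c w - l' • (h c).vec n) :
      HalfLineL2) =ᵐ[volume.restrict (Ioi (0 : ℝ))] fun x => deriv (fun t => psi t n x) c := by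
    filter_upwards [
      Lp.coeFn_smul (lam c n)⁻¹
        (airyL2Op 1 c ((h c).vec n) + airyL2Op 0 c w - l' • (h c).vec n),
      Lp.coeFn_sub (airyL2Op 1 c ((h c).vec n) + airyL2Op 0 c w) (l' • (h c).vec n),
      Lp.coeFn_add (airyL2Op 1 c ((h c).vec n)) (airyL2Op 0 c w),
      Lp.coeFn_smul l' ((h c).vec n), (h c).coeFn_vec n,
      hankelOp_spec (isExpKernel_one_airyKernel c 1) ((h c).vec n),
      hankelOp_spec (isExpKernel_one_airyKernel c 0) w, ae_restrict_mem measurableSet_Ioi]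
      with x h1 h2 h3 h4 h5 h6 h7 hx
    have hx : 0 < x := hx
    rw [(hd x hx.le).deriv, h1, Pi.smul_apply, h2, Pi.sub_apply, h3, Pi.add_apply, h4,
      Pi.smul_apply, h5, airyL2Op, h6, airyL2Op, h7, hankel_airyKernel_eq_inner,
      hankel_airyKernel_eq_inner, (h c).apply_eq_inner n hx.le, smul_eq_mul, smul_eq_mul]
    field_simp
    ring
  rwa [← hw'] at hae

end Family

section Family

variable {lam : ℝ → ℕ → ℝ} {psi : ℝ → ℕ → ℝ → ℝ}

lemma differentiableAt_eigenfunction (h : ∀ c : ℝ, IsAiryEigensystem c (lam c) (psi c)) (c : ℝ)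
    (n : ℕ) (x : ℝ) (hx : 0 ≤ x) : DifferentiableAt ℝ (fun t => psi t n x) c := by
  obtain ⟨w, l', -, hd, -⟩ := exists_deriv_eigenfunction h c n
  exact hd x hx

/-- Pair the differentiated eigenvalue equation with `ψ_m`: the term with `λ_n'` drops by
orthogonality, symmetry gives `⟪T_c w, ψ_m⟫ = λ_m ⟪w, ψ_m⟫`, and the `c`-derivative of the operator
sends `ψ_n` to `λ_n ψ_n'`, since the kernel depends on `x + y + c` only. -/
lemma integral_deriv_param_mul (h : ∀ c : ℝ, IsAiryEigensystem c (lam c) (psi c)) (c : ℝ)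
    {m n : ℕ} (hmn : m ≠ n) :
    IntegrableOn (fun x => deriv (fun t : ℝ => psi t n x) c * psi c m x) (Ioi 0) ∧
      ∫ x in Ioi (0 : ℝ), deriv (fun t : ℝ => psi t n x) c * psi c m x
        = lam c n * lam c m / (lam c m ^ 2 - lam c n ^ 2) * (psi c m 0 * psi c n 0) := by
  obtain ⟨w, l', hrel, -, hw⟩ := exists_deriv_eigenfunction h c n
  have hm := (h c).coeFn_vec m
  have hae : (fun x => w x * (h c).vec m x) =ᵐ[volume.restrict (Ioi (0 : ℝ))]
      fun x => deriv (fun t : ℝ => psi t n x) c * psi c m x := by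
    filter_upwards [hw, hm] with x h1 h2
    rw [h1, h2]
  refine ⟨((halfLineL2_memLp w).integrable_mul (halfLineL2_memLp _)).congr hae, ?_⟩
  rw [← integral_congr_ae hae, ← halfLineL2_inner]
  have hn0 := (h c).lam_ne_zero n
  have hT1 : ⟪airyL2Op 1 c ((h c).vec n), (h c).vec m⟫
      = lam c n * ∫ x in Ioi (0 : ℝ), derivWithin (psi c n) (Ici 0) x * psi c m x := by
    rw [halfLineL2_inner, ← integral_const_mul]
    refine integral_congr_ae ?_
    filter_upwards [hankelOp_spec (isExpKernel_one_airyKernel c 1) ((h c).vec n), hm,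
      ae_restrict_mem measurableSet_Ioi] with x h1 h2 hx
    rw [airyL2Op, h1, h2, hankel_congr_ae ((h c).coeFn_vec n),
      ((h c).eigen n).derivWithin_eq hn0 (le_of_lt hx), eigenDeriv, ← mul_assoc,
      mul_inv_cancel_left₀ hn0]
  have hinner := congrArg (fun v : HalfLineL2 => ⟪v, (h c).vec m⟫) hrel
  have hT0 : ⟪airyL2Op 0 c w, (h c).vec m⟫ = lam c m * ⟪w, (h c).vec m⟫ := by
    rw [airyL2Op, hankelOp_symm]
    rw [← airyL2Op, (h c).airyL2Op_vec, real_inner_smul_right]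
  simp only [inner_add_left, real_inner_smul_left] at hinner
  rw [hT1, hT0, (h c).orthonormal_vec.2 hmn.symm, ((h c).integral_deriv_mul m n).2] at hinner
  have hs := (h c).add_ne_zero n m
  have hs' := (h c).sq_sub_sq_ne_zero hmn.symm
  have hd : lam c m - lam c n ≠ 0 := sub_ne_zero.2 fun e => hmn ((h c).lam_injective e)
  rw [div_mul_eq_mul_div, eq_div_iff hs']
  field_simp at hinner
  linear_combination hinner

end Family

theorem theoremA3
    (lam : ℝ → ℕ → ℝ) (psi : ℝ → ℕ → ℝ → ℝ)
    (h : ∀ c : ℝ, IsAiryEigensystem c (lam c) (psi c))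
    (c : ℝ) (m n : ℕ) :
    -- the derivatives of the eigenfunctions in `x` and in `c` exist
    ContDiffOn ℝ 2 (psi c n) (Ici 0) ∧
    (∀ x : ℝ, 0 ≤ x → DifferentiableAt ℝ (fun t : ℝ => psi t n x) c) ∧
    -- the integral of `psi_n' psi_m`
    (lam c n + lam c m ≠ 0 ∧
      IntegrableOn (fun x => derivWithin (psi c n) (Ici 0) x * psi c m x) (Ioi 0) ∧
      ∫ x in Ioi (0 : ℝ), derivWithin (psi c n) (Ici 0) x * psi c m x
        = -(lam c m / (lam c n + lam c m)) * (psi c n 0 * psi c m 0)) ∧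
    (m ≠ n →
      (lam c n - lam c m ≠ 0 ∧ lam c n ^ 2 - lam c m ^ 2 ≠ 0) ∧
      -- the integral of `psi_n'' psi_m`
      (IntegrableOn (fun x => iteratedDerivWithin 2 (psi c n) (Ici 0) x * psi c m x) (Ioi 0) ∧
        ∫ x in Ioi (0 : ℝ), iteratedDerivWithin 2 (psi c n) (Ici 0) x * psi c m x
          = lam c m / (lam c n - lam c m) *
            (derivWithin (psi c n) (Ici 0) 0 * psi c m 0
              - psi c n 0 * derivWithin (psi c m) (Ici 0) 0)) ∧
      -- the integral of `x psi_n psi_m`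
      (IntegrableOn (fun x => x * psi c n x * psi c m x) (Ioi 0) ∧
        ∫ x in Ioi (0 : ℝ), x * psi c n x * psi c m x
          = lam c n * lam c m / (lam c n ^ 2 - lam c m ^ 2) *
            (derivWithin (psi c n) (Ici 0) 0 * psi c m 0
              - psi c n 0 * derivWithin (psi c m) (Ici 0) 0)) ∧
      -- the integral of `(∂ psi_n / ∂ c) psi_m`
      (IntegrableOn (fun x => deriv (fun t : ℝ => psi t n x) c * psi c m x) (Ioi 0) ∧
        ∫ x in Ioi (0 : ℝ), deriv (fun t : ℝ => psi t n x) c * psi c m x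
          = lam c n * lam c m / (lam c m ^ 2 - lam c n ^ 2) * (psi c m 0 * psi c n 0))) := by
  refine ⟨((h c).eigen n).contDiffOn ((h c).lam_ne_zero n), differentiableAt_eigenfunction h c n,
    ⟨(h c).add_ne_zero n m, (h c).integral_deriv_mul m n⟩, fun hmn => ⟨⟨sub_ne_zero.2 fun e =>
      hmn ((h c).lam_injective e).symm, (h c).sq_sub_sq_ne_zero hmn⟩,
      (h c).integral_deriv_two_mul hmn, (h c).integral_id_mul_mul hmn,
      integral_deriv_param_mul h c hmn⟩⟩
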